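/- Let $\mathbb K$ be $\mathbb R$ or $\mathbb C$, let $1\le k\le d-1$, and put $\theta=\{k,d-k\}$. For $g\in\mathsf{PGL}(d,\mathbb K)$ let $\sigma_1(g)\ge\dots\ge\sigma_d(g)>0$ be the singular values of a representative of $g$ whose determinant has modulus $1$, let $\kappa(g)=\mathrm{diag}(\log\sigma_1(g),\dots,\log\sigma_d(g))$, and let $\alpha_j(\kappa(g))=\log\sigma_j(g)-\log\sigma_{j+1}(g)$. If $\alpha_j(\kappa(g))>0$, let $U_j(g)=\ell\langle e_1,\dots,e_j\rangle$, where $g=\ell\exp(\kappa(g))m$ with $\ell,m$ orthogonal (unitary if $\mathbb K=\mathbb C$). Let $\mathcal F_\theta$ be the space of partial flags $F=(F^j)_{j\in\theta}$ in $\mathbb K^d$ with $\dim F^j=j$ and $F^i\subset F^j$ for $i\le j$. Each Grassmannian $\mathrm{Gr}_j(\mathbb K^d)$ carries the metric pulled back by the Plücker embedding from the angle metric on $\mathbb P(\bigwedge^j\mathbb K^d)$, and $\mathcal F_\theta$ the metric induced by the product $\prod_{j\in\theta}\mathrm{Gr}_j(\mathbb K^d)$. Let $\Gamma\subset\mathsf{PGL}(d,\mathbb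 K)$ be a $P_{k,d-k}$-transverse subgroup. That is, for $j\in\theta$ one has $\alpha_j(\kappa(\gamma_n))\to\infty$ for every sequence $(\gamma_n)$ of pairwise distinct elements of $\Gamma$; and, if $\Lambda_{k,d-k}(\Gamma)\subset\mathcal F_\theta$ denotes the set of all limits of sequences $(U_j(\gamma_n))_{j\in\theta}$ with $\gamma_n\in\Gamma$ pairwise distinct, then $F^j\oplus G^{d-j}=\mathbb K^d$ for all distinct $F,G\in\Lambda_{k,d-k}(\Gamma)$ and $j\in\theta$. Let $\Lambda_{k,d-k,c}(\Gamma)$ be the set of conical limit points, i.e. of those $x\in\Lambda_{k,d-k}(\Gamma)$ for which there are pairwise distinct $\gamma_n\in\Gamma$ and points $a\ne b$ in $\Lambda_{k,d-k}(\Gamma)$ such that $\gamma_n(x)\to a$ and $\gamma_n(y)\to b$ for all $y\in\Lambda_{k,d-k}(\Gamma)\setminus\{x\}$. Let $\Lambda_{k,c}(\Gamma)\subset\mathrm{Gr}_k(\mathbb K^d)$ be its image under $F\mapsto F^k$. Let $$\delta^{\alpha_k}(\Gamma)=\inf\Big\{s\ge0:\ \sum_{\gamma\in\Gamma}e^{-s\alpha_k(\kappa(\gamma))}<\infty\Big\}\in[0,\infty].$$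 Then $$\dim_H\big(\Lambda_{k,d-k,c}(\Gamma)\big)\le\delta^{\alpha_k}(\Gamma).$$ In particular, $\dim_H\big(\Lambda_{k,c}(\Gamma)\big)\le\delta^{\alpha_k}(\Gamma)$. (Here $\dim_H\emptyset=0$.) -/

import Mathlib

open Filter Topology
open scoped ENNReal NNReal MatrixGroups

noncomputable section

namespace TransverseGroup

variable {K : Type*} [RCLike K] {d : ℕ}

/-! ### The angle between two lines -/

/-- The angle in `[0, π/2]` between the `K`-lines spanned by two nonzero vectors `x` and `y`:
its cosine is `|⟨x, y⟩| / (‖x‖ ‖y‖)`. -/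
def lineAngle {H : Type*} [NormedAddCommGroup H] [InnerProductSpace K H] (x y : H) : ℝ :=
  Real.arccos (‖inner K x y‖ / (‖x‖ * ‖y‖))

section Angle

variable {H : Type*} [NormedAddCommGroup H] [InnerProductSpace K H]

theorem lineAngle_comm (x y : H) : lineAngle (K := K) x y = lineAngle (K := K) y x := by
  unfold lineAngle
  rw [norm_inner_symm, mul_comm]

theorem lineAngle_smul_left (x y : H) {c : K} (hc : c ≠ 0) :
    lineAngle (K := K) (c • x) y = lineAngle (K := K) x y := by
  have : ‖c‖ ≠ 0 := norm_ne_zero_iff.2 hc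
  unfold lineAngle
  rw [inner_smul_left, norm_mul, norm_smul, RCLike.norm_conj, mul_assoc,
    mul_div_mul_left _ _ this]

theorem lineAngle_eq_zero_iff {x y : H} (hx : x ≠ 0) (hy : y ≠ 0) :
    lineAngle (K := K) x y = 0 ↔ ∃ r : K, r ≠ 0 ∧ y = r • x := by
  have h := norm_inner_div_norm_mul_norm_eq_one_iff (𝕜 := K) x y
  have h0 : ‖inner K x y / ((‖x‖ : K) * (‖y‖ : K))‖ = ‖inner K x y‖ / (‖x‖ * ‖y‖) := by
    simp
  rw [h0] at h
  have hpos : 0 < ‖x‖ * ‖y‖ := mul_pos (norm_pos_iff.2 hx) (norm_pos_iff.2 hy)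
  have hle : ‖inner K x y‖ / (‖x‖ * ‖y‖) ≤ 1 := by
    rw [div_le_one hpos]; exact norm_inner_le_norm x y
  unfold lineAngle
  rw [Real.arccos_eq_zero]
  constructor
  · intro h1
    exact (h.1 (le_antisymm hle h1)).2
  · intro h1
    exact (h.2 ⟨hx, h1⟩).ge

/-- Some multiple `c • y` with `|c| = 1` has real nonnegative inner product with `x`. -/
theorem exists_phase (x y : H) : ∃ c : K, ‖c‖ = 1 ∧ inner K x (c • y) = (‖inner K x y‖ : K) := by
  by_cases h : inner K x y = 0
  · exact ⟨1, by simp, by simp [h]⟩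
  · have hn : (‖inner K x y‖ : K) ≠ 0 := by simpa using h
    refine ⟨(starRingEnd K) (inner K x y) / (‖inner K x y‖ : K), ?_, ?_⟩
    · have : ‖inner K x y‖ ≠ 0 := norm_ne_zero_iff.2 h
      rw [norm_div, RCLike.norm_conj, RCLike.norm_ofReal, abs_norm, div_self this]
    · rw [inner_smul_right, div_mul_eq_mul_div, RCLike.conj_mul, pow_two,
        mul_div_assoc, div_self hn, mul_one]

theorem lineAngle_triangle (x y z : H) :
    lineAngle (K := K) x z ≤ lineAngle (K := K) x y + lineAngle (K := K) y z := by
  let _ : InnerProductSpace ℝ H := InnerProductSpace.rclikeToReal K H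
  obtain ⟨c, hc, hcy⟩ := exists_phase (K := K) x y
  obtain ⟨e, he, hez⟩ := exists_phase (K := K) (c • y) z
  have key := InnerProductGeometry.angle_le_angle_add_angle x (c • y) (e • z)
  have hn1 : ‖c • y‖ = ‖y‖ := by rw [norm_smul, hc, one_mul]
  have hn2 : ‖e • z‖ = ‖z‖ := by rw [norm_smul, he, one_mul]
  have h1 : InnerProductGeometry.angle x (c • y) = lineAngle (K := K) x y := by
    unfold InnerProductGeometry.angle lineAngle
    rw [real_inner_eq_re_inner K, hcy, RCLike.ofReal_re, hn1]
  have h2 : InnerProductGeometry.angle (c • y) (e • z) = lineAngle (K := K) y z := by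
    unfold InnerProductGeometry.angle lineAngle
    rw [real_inner_eq_re_inner K, hez, RCLike.ofReal_re, hn1, hn2, inner_smul_left, norm_mul,
      RCLike.norm_conj, hc, one_mul]
  have h3 : lineAngle (K := K) x z ≤ InnerProductGeometry.angle x (e • z) := by
    unfold InnerProductGeometry.angle lineAngle
    apply Real.arccos_le_arccos
    rw [real_inner_eq_re_inner K, hn2]
    gcongr
    refine (RCLike.re_le_norm _).trans ?_
    rw [inner_smul_right, norm_mul, he, one_mul]
  linarith

end Angle

/-! ### Grassmannians -/

/-- The Grassmannian of `k`-dimensional linear subspaces of `K ^ d`. -/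
@[ext]
structure Gr (K : Type*) [RCLike K] (d k : ℕ) where
  /-- the underlying linear subspace -/
  carrier : Submodule K (EuclideanSpace K (Fin d))
  finrank_eq : Module.finrank K carrier = k

/-- A basis `b_1, …, b_k` of a `k`-dimensional subspace. -/
def Gr.basis {k : ℕ} (V : Gr K d k) : Module.Basis (Fin k) K V.carrier :=
  Module.finBasisOfFinrankEq K V.carrier V.finrank_eq

/-- The coordinates of an element of `⋀^k K^d` in the standard basis
`e_{i_1} ∧ ⋯ ∧ e_{i_k}`, `i_1 < ⋯ < i_k`; the standard inner product of `⋀^k K^d` is the one for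
which this basis is orthonormal. -/
def wedgeCoord (k : ℕ) :
    (⋀[K]^k (EuclideanSpace K (Fin d))) ≃ₗ[K]
      EuclideanSpace K (Set.powersetCard (Fin d) k) :=
  (((EuclideanSpace.basisFun (Fin d) K).toBasis.exteriorPower k).equivFun).trans
    (WithLp.linearEquiv 2 K (Set.powersetCard (Fin d) k → K)).symm

/-- A vector `b_1 ∧ ⋯ ∧ b_k` spanning the line in `⋀^k K^d` attached to a `k`-dimensional
subspace by the Plücker embedding. -/
def Gr.plucker {k : ℕ} (V : Gr K d k) : EuclideanSpace K (Set.powersetCard (Fin d) k) :=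
  wedgeCoord k (exteriorPower.ιMulti K k fun i => (V.basis i : EuclideanSpace K (Fin d)))

/-- Proportional Plücker vectors come from the same subspace (one inclusion). -/
theorem Gr.le_of_plucker {k : ℕ} (V W : Gr K d k) (r : K)
    (h : V.plucker = r • W.plucker) : W.carrier ≤ V.carrier := by
  intro w hw
  by_contra hwV
  have hind : LinearIndependent K (fun i => (V.basis i : EuclideanSpace K (Fin d))) :=
    V.basis.linearIndependent.map' V.carrier.subtype (Submodule.ker_subtype _)
  have hspan : Submodule.span K (Set.range fun i => (V.basis i : EuclideanSpace K (Fin d)))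
      = V.carrier := by
    have : (Set.range fun i => (V.basis i : EuclideanSpace K (Fin d)))
        = V.carrier.subtype '' Set.range V.basis := by
      rw [← Set.range_comp]; rfl
    rw [this, Submodule.span_image, V.basis.span_eq, Submodule.map_top, Submodule.range_subtype]
  have hind2 : LinearIndependent K
      (Fin.cons w (fun i => (V.basis i : EuclideanSpace K (Fin d))) : Fin (k + 1) → _) := by
    rw [linearIndependent_finCons]
    exact ⟨hind, by rwa [hspan]⟩
  -- a linear map to `K ^ k` that kills `w` and sends the basis of `V` to the standard basis
  obtain ⟨T, hT⟩ : ∃ T : EuclideanSpace K (Fin d) →ₗ[K] (Fin k → K),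
      T w = 0 ∧ ∀ i, T (V.basis i) = Pi.single i 1 := by
    let B := Module.Basis.extend hind2.linearIndepOn_id
    let v : Fin (k + 1) → EuclideanSpace K (Fin d) :=
      Fin.cons w (fun i => (V.basis i : EuclideanSpace K (Fin d)))
    obtain ⟨S, hS⟩ := LinearMap.exists_leftInverse_of_injective
      (Fintype.linearCombination K v)
      (by
        rw [LinearMap.ker_eq_bot]
        exact linearIndependent_iff_injective_fintypeLinearCombination.1 hind2)
    have hSv : ∀ j, S (v j) = Pi.single j 1 := by
      intro j
      have := LinearMap.congr_fun hS (Pi.single j 1)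
      simpa [Fintype.linearCombination_apply_single] using this
    refine ⟨(LinearMap.funLeft K K Fin.succ).comp S, ?_, ?_⟩
    · have := hSv 0
      ext i
      simp only [v, Fin.cons_zero] at this
      simp [this, LinearMap.funLeft_apply]
    · intro i
      have := hSv i.succ
      simp only [v, Fin.cons_succ] at this
      ext j
      simp [this, LinearMap.funLeft_apply, Pi.single_apply]
  obtain ⟨hTw, hTV⟩ := hT
  let f : EuclideanSpace K (Fin d) [⋀^Fin k]→ₗ[K] K := Matrix.detRowAlternating.compLinearMap T
  have hfV : f (fun i => (V.basis i : EuclideanSpace K (Fin d))) = 1 := by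
    have : (fun i => T (V.basis i)) = (1 : Matrix (Fin k) (Fin k) K) := by
      ext i j
      rw [hTV, Pi.single_apply, Matrix.one_apply]
      simp [eq_comm]
    change Matrix.det (fun i => T (V.basis i)) = 1
    rw [this, Matrix.det_one]
  have hfW : f (fun i => (W.basis i : EuclideanSpace K (Fin d))) = 0 := by
    change Matrix.det (fun i => T (W.basis i)) = 0
    by_contra hdet
    have hli : LinearIndependent K (fun i => T (W.basis i)) :=
      Matrix.linearIndependent_rows_of_det_ne_zero hdet
    have hinj : Function.Injective (T ∘ₗ W.carrier.subtype) := by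
      rw [← LinearMap.ker_eq_bot, LinearMap.ker_eq_bot']
      intro m hm
      have hrep := W.basis.sum_repr m
      rw [← hrep, map_sum] at hm
      simp only [map_smul] at hm
      have hz := Fintype.linearIndependent_iff.1 hli _ hm
      rw [← hrep]
      exact Finset.sum_eq_zero fun i _ => by rw [hz i, zero_smul]
    have hw0 : (⟨w, hw⟩ : W.carrier) = 0 := hinj (by simp [hTw])
    have : w = 0 := congrArg Subtype.val hw0
    exact hwV (this ▸ V.carrier.zero_mem)
  have hwedge : exteriorPower.ιMulti K k (fun i => (V.basis i : EuclideanSpace K (Fin d)))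
      = r • exteriorPower.ιMulti K k (fun i => (W.basis i : EuclideanSpace K (Fin d))) := by
    apply (wedgeCoord (K := K) (d := d) k).injective
    rw [map_smul]
    exact h
  have := congrArg (exteriorPower.alternatingMapLinearEquiv f) hwedge
  rw [map_smul, exteriorPower.alternatingMapLinearEquiv_apply_ιMulti,
    exteriorPower.alternatingMapLinearEquiv_apply_ιMulti, hfV, hfW, smul_zero] at this
  exact one_ne_zero this

theorem Gr.plucker_ne_zero {k : ℕ} (V : Gr K d k) : V.plucker ≠ 0 := by
  intro h0
  have hind : LinearIndependent K (fun i => (V.basis i : EuclideanSpace K (Fin d))) :=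
    V.basis.linearIndependent.map' V.carrier.subtype (Submodule.ker_subtype _)
  have h1 := exteriorPower.ιMulti_family_linearIndependent_field (n := k) hind
  let s : Set.powersetCard (Fin k) k := ⟨Finset.univ, by simp [Set.powersetCard]⟩
  have h3 : exteriorPower.ιMulti K k (fun i => (V.basis i : EuclideanSpace K (Fin d))) = 0 :=
    (wedgeCoord (K := K) (d := d) k).injective (by rw [map_zero]; exact h0)
  have hid : ∀ i, Set.powersetCard.ofFinEmbEquiv.symm s i = i := by
    intro i
    have hs : StrictMono (Set.powersetCard.ofFinEmbEquiv.symm s) :=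
      (Set.powersetCard.ofFinEmbEquiv.symm s).strictMono
    have hr : Set.range (Set.powersetCard.ofFinEmbEquiv.symm s) = Set.range (id : Fin k → Fin k) := by
      rw [(Finite.surjective_of_injective hs.injective).range_eq, Set.range_id]
    exact congrFun ((hs.range_inj strictMono_id).1 hr) i
  apply h1.ne_zero s
  rw [exteriorPower.ιMulti_family, ← h3]
  congr 1
  ext i
  simp [hid]

/-- The metric of the Grassmannian: the pullback under the Plücker embedding of the angle metric
on the projective space of `⋀^k K^d`. -/
instance (k : ℕ) : MetricSpace (Gr K d k) where
  dist V W := lineAngle (K := K) V.plucker W.plucker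
  dist_self V := (lineAngle_eq_zero_iff V.plucker_ne_zero V.plucker_ne_zero).2
    ⟨1, one_ne_zero, (one_smul K _).symm⟩
  dist_comm V W := lineAngle_comm _ _
  dist_triangle U V W := lineAngle_triangle _ _ _
  eq_of_dist_eq_zero {V W} h := by
    obtain ⟨r, hr, hW⟩ := (lineAngle_eq_zero_iff V.plucker_ne_zero W.plucker_ne_zero).1 h
    apply Gr.ext
    apply le_antisymm
    · exact Gr.le_of_plucker W V r hW
    · refine Gr.le_of_plucker V W r⁻¹ ?_
      rw [hW, smul_smul, inv_mul_cancel₀ hr, one_smul]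

/-! ### The group `PGL(d, K)` -/

/-- Every `g ∈ PGL(d, K)` has a representative whose determinant has modulus `1`. -/
theorem exists_rep (g : PGL(d, K)) :
    ∃ A : GL (Fin d) K, Matrix.ProjGenLinGroup.mk A = g ∧ ‖(A : Matrix (Fin d) (Fin d) K).det‖ = 1 := by
  obtain ⟨A, rfl⟩ := Matrix.ProjGenLinGroup.mk_surjective g
  rcases Nat.eq_zero_or_pos d with rfl | hd
  · exact ⟨A, rfl, by simp [Matrix.det_fin_zero]⟩
  have hdet : (A : Matrix (Fin d) (Fin d) K).det ≠ 0 :=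
    ((Matrix.isUnit_iff_isUnit_det _).1 A.isUnit).ne_zero
  have hpos : 0 < ‖(A : Matrix (Fin d) (Fin d) K).det‖ := norm_pos_iff.2 hdet
  let c : ℝ := ‖(A : Matrix (Fin d) (Fin d) K).det‖ ^ (-(1 / (d : ℝ)))
  have hc : 0 < c := Real.rpow_pos_of_pos hpos _
  have hcK : (c : K) ≠ 0 := by exact_mod_cast hc.ne'
  refine ⟨A * .scalar (Fin d) (Units.mk0 (c : K) hcK), ?_, ?_⟩
  · rw [map_mul, Matrix.ProjGenLinGroup.mk_scalar, mul_one]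
  · have : c ^ d = ‖(A : Matrix (Fin d) (Fin d) K).det‖⁻¹ := by
      rw [← Real.rpow_natCast, ← Real.rpow_mul hpos.le, neg_mul, one_div,
        inv_mul_cancel₀ (by positivity), Real.rpow_neg_one]
    simp [Matrix.det_mul, this, abs_of_pos hc, hpos.ne']

/-- A representative of `g ∈ PGL(d, K)` whose determinant has modulus `1`; it is unique up to a
scalar of modulus `1`, on which none of the notions below depends. -/
def rep (g : PGL(d, K)) : GL (Fin d) K := (exists_rep g).choose

theorem mk_rep (g : PGL(d, K)) : Matrix.ProjGenLinGroup.mk (rep g) = g :=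
  (exists_rep g).choose_spec.1

theorem norm_det_rep (g : PGL(d, K)) : ‖(rep g : Matrix (Fin d) (Fin d) K).det‖ = 1 :=
  (exists_rep g).choose_spec.2

/-- The linear map of `K ^ d` given by the representative of `g`. -/
def repLin (g : PGL(d, K)) : EuclideanSpace K (Fin d) →ₗ[K] EuclideanSpace K (Fin d) :=
  Matrix.toEuclideanLin (rep g : Matrix (Fin d) (Fin d) K)

theorem repLin_injective (g : PGL(d, K)) : Function.Injective (repLin g) := by
  have h : ((rep g)⁻¹ : GL (Fin d) K).val * (rep g).val = 1 := (rep g).inv_mul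
  intro x y hxy
  have h1 : (rep g).val.mulVec x.ofLp = (rep g).val.mulVec y.ofLp := by
    simpa [repLin, Matrix.toLpLin_apply] using hxy
  have h2 := congrArg (fun v => ((rep g)⁻¹ : GL (Fin d) K).val.mulVec v) h1
  simp only [Matrix.mulVec_mulVec, h, Matrix.one_mulVec] at h2
  exact (WithLp.ofLp_injective 2) h2

/-- The action of `PGL(d, K)` on the Grassmannian. -/
def actGr (g : PGL(d, K)) {k : ℕ} (V : Gr K d k) : Gr K d k where
  carrier := V.carrier.map (repLin g)
  finrank_eq := by
    rw [← (Submodule.equivMapOfInjective _ (repLin_injective g) V.carrier).finrank_eq,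
      V.finrank_eq]

/-- The Cartan projection `κ(g) = (log σ_1(g), …, log σ_d(g))`, where
`σ_1(g) ≥ ⋯ ≥ σ_d(g)` are the singular values of the representative of `g`. -/
def cartan (g : PGL(d, K)) : Fin d → ℝ := fun i => Real.log ((repLin g).singularValues i)

/-- The simple root `α_k(A) = A_k - A_{k+1}`, for `1 ≤ k ≤ d - 1`
(the coordinates of `A` are numbered from `0` here; the value is irrelevant for other `k`). -/
def simpleRoot (k : ℕ) (A : Fin d → ℝ) : ℝ :=
  if h : 1 ≤ k ∧ k < d then A ⟨k - 1, by omega⟩ - A ⟨k, h.2⟩ else 0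

/-! ### Flags -/

/-- The space of partial flags of `K ^ d` with one subspace of each dimension in `θ`. Its metric
is the one induced by the product of the Grassmannians. -/
abbrev Flag (K : Type*) [RCLike K] (d : ℕ) (θ : Finset ℕ) : Type _ :=
  {F : (j : θ) → Gr K d j // ∀ i j : θ, (i : ℕ) ≤ j → (F i).carrier ≤ (F j).carrier}

/-- The action of `PGL(d, K)` on partial flags. -/
def actFlag {θ : Finset ℕ} (g : PGL(d, K)) (F : Flag K d θ) : Flag K d θ :=
  ⟨fun j => actGr g (F.1 j), fun i j hij => Submodule.map_mono (F.2 i j hij)⟩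

/-- A set of flags is transverse if `F^k` and `G^{d-k}` are complementary subspaces for all
distinct flags `F`, `G` in it. -/
def IsTransverseSet {θ : Finset ℕ} (X : Set (Flag K d θ)) : Prop :=
  ∀ F ∈ X, ∀ G ∈ X, F ≠ G → ∀ i j : θ, (i : ℕ) + j = d →
    IsCompl (F.1 i).carrier (G.1 j).carrier

/-- `F = U_θ(g)`: the numbers `α_k(κ(g))`, `k ∈ θ`, are positive, and for some Cartan decomposition
`g = ℓ exp(κ(g)) m`, with `ℓ` and `m` orthogonal or unitary, `F^k = ℓ ⟨e_1, …, e_k⟩` for all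
`k ∈ θ`. -/
def IsCartanFlag {θ : Finset ℕ} (g : PGL(d, K)) (F : Flag K d θ) : Prop :=
  (∀ k ∈ θ, 0 < simpleRoot k (cartan g)) ∧
  ∃ ℓ ∈ Matrix.unitaryGroup (Fin d) K, ∃ m ∈ Matrix.unitaryGroup (Fin d) K,
    (rep g : Matrix (Fin d) (Fin d) K)
      = ℓ * Matrix.diagonal (fun i => ((Real.exp (cartan g i) : ℝ) : K)) * m ∧
    ∀ k : θ, (F.1 k).carrier = Submodule.span K
      ((fun i : Fin d => Matrix.toEuclideanLin ℓ (EuclideanSpace.single i (1 : K))) ''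
        {i | (i : ℕ) < k})

/-! ### Divergent and transverse groups -/

/-- `Γ` is `P_k`-divergent: `α_k(κ(γ_n)) → ∞` for every sequence of pairwise distinct elements. -/
def IsDivergent (k : ℕ) (Γ : Subgroup PGL(d, K)) : Prop :=
  ∀ γ : ℕ → PGL(d, K), (∀ n, γ n ∈ Γ) → Function.Injective γ →
    Tendsto (fun n => simpleRoot k (cartan (γ n))) atTop atTop

/-- The limit set `Λ_θ(Γ)`: the limits of the sequences `U_θ(γ_n)`, for sequences `γ_n` of
pairwise distinct elements of `Γ`. -/
def limitSet (θ : Finset ℕ) (Γ : Subgroup PGL(d, K)) : Set (Flag K d θ) :=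
  {F | ∃ (γ : ℕ → PGL(d, K)) (U : ℕ → Flag K d θ), (∀ n, γ n ∈ Γ) ∧ Function.Injective γ ∧
    (∀ n, IsCartanFlag (γ n) (U n)) ∧ Tendsto U atTop (𝓝 F)}

/-- `Γ` is `P_θ`-transverse: it is `P_k`-divergent for all `k ∈ θ` and its limit set is a
transverse set of flags. -/
def IsTransverse (θ : Finset ℕ) (Γ : Subgroup PGL(d, K)) : Prop :=
  (∀ k ∈ θ, IsDivergent k Γ) ∧ IsTransverseSet (limitSet θ Γ)

/-- The conical limit set `Λ_{θ,c}(Γ)`: the conical limit points of the action of `Γ` on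
`Λ_θ(Γ)`. -/
def conicalLimitSet (θ : Finset ℕ) (Γ : Subgroup PGL(d, K)) : Set (Flag K d θ) :=
  {x | x ∈ limitSet θ Γ ∧ ∃ γ : ℕ → PGL(d, K), (∀ n, γ n ∈ Γ) ∧ Function.Injective γ ∧
    ∃ a ∈ limitSet θ Γ, ∃ b ∈ limitSet θ Γ, a ≠ b ∧
      Tendsto (fun n => actFlag (γ n) x) atTop (𝓝 a) ∧
      ∀ y ∈ limitSet θ Γ, y ≠ x → Tendsto (fun n => actFlag (γ n) y) atTop (𝓝 b)}

/-- The projection `Λ_{k,c}(Γ)` of the conical limit set to the Grassmannian of `k`-planes. -/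
def conicalLimitSetGr (θ : Finset ℕ) (k : θ) (Γ : Subgroup PGL(d, K)) : Set (Gr K d k) :=
  (fun F : Flag K d θ => F.1 k) '' conicalLimitSet θ Γ

/-- The Poincaré series `∑_{γ ∈ Γ} exp(-s φ(κ(γ)))`, with values in `[0, ∞]`. -/
def poincareSeries (φ : (Fin d → ℝ) → ℝ) (Γ : Subgroup PGL(d, K)) (s : ℝ) : ℝ≥0∞ :=
  ∑' γ : Γ, ENNReal.ofReal (Real.exp (-s * φ (cartan (γ : PGL(d, K)))))

/-- The critical exponent, in `[0, ∞]`: the infimum of the `s ≥ 0` at which the Poincaré series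
converges (`∞` if there is none). When `φ ∘ κ ≥ 0` and `Γ` is infinite, the series diverges for
all `s ≤ 0`, so the restriction to `s ≥ 0` only sets the value for finite groups, to `0`. -/
def criticalExponent (φ : (Fin d → ℝ) → ℝ) (Γ : Subgroup PGL(d, K)) : ℝ≥0∞ :=
  ⨅ (s : ℝ≥0) (_ : poincareSeries φ Γ s < ∞), (s : ℝ≥0∞)

end TransverseGroup

end

/-! The bound is a Borel–Cantelli covering argument: every conical point lies in infinitely many
shadows, and the Poincaré series of `α_k` controls the sizes of the shadows.

Let `x` be conical, with `γ_n x → a` and `γ_n y → b` for the other `y`, and put `g_n = γ_n⁻¹ = L_n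
exp(κ(g_n)) M_n`. By compactness `L_n` and `M_n` may be assumed to converge. The repelling flag of
`g_n` is the attracting flag of `γ_n`, and its limit must be `b`, because `γ_n` attracts a suitable
third limit point to it. Since `a ≠ b`, transversality keeps `γ_n x` uniformly away from the planes
that meet the repelling ones. As `x = g_n (γ_n x)`, the contraction estimate `dist_frame_le` places
`x^j` within `C exp(-α_j(κ(g_n)))` of the attracting `j`-plane of `g_n`, for both `j` in `θ`. This
is `infinite_shadow_of_mem_conicalLimitSet`.

The contraction takes place in Plücker coordinates. On `⋀^j K^d` the diagonal part multiplies the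
coordinate of a `j`-subset by the exponential of the sum of the corresponding entries of `κ`. The
initial subset has the largest sum, and every other one loses at least `α_j` (`sum_enum_le`).

A shadow of `g` has diameter at most a constant times `max (exp(-α_k(κ(g)))) (exp(-α_{d-k}(κ(g))))`.
Since `α_{d-k}(κ(g)) = α_k(κ(g⁻¹))`, the `s`-th powers sum to at most a constant times twice the
Poincaré series at `s`. When that converges, `dimH_le_of_tsum_rpow_ne_top` bounds by `s` the
dimension of the points with a given constant `C`; a countable union over `C` finishes the proof.
The projection to the Grassmannian is 1-Lipschitz. -/

namespace TransverseGroup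

variable {K : Type*} [RCLike K] {d j : ℕ} {θ : Finset ℕ}

/-! ### Exterior powers in coordinates -/

/-- The increasing enumeration of a `j`-element subset of `Fin d`. -/
abbrev enum (s : Set.powersetCard (Fin d) j) : Fin j ↪o Fin d :=
  Set.powersetCard.ofFinEmbEquiv.symm s

/-- The coordinates of `b_1 ∧ ⋯ ∧ b_j`. -/
noncomputable def wedge (b : Fin j → EuclideanSpace K (Fin d)) :
    EuclideanSpace K (Set.powersetCard (Fin d) j) :=
  wedgeCoord j (exteriorPower.ιMulti K j b)

theorem wedge_apply (b : Fin j → EuclideanSpace K (Fin d)) (s : Set.powersetCard (Fin d) j) :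
    wedge b s = (Matrix.of fun i c => b i (enum s c)).det := by
  have : wedge b s = (((EuclideanSpace.basisFun (Fin d) K).toBasis.exteriorPower j).repr
      (exteriorPower.ιMulti K j b)) s := rfl
  rw [this, exteriorPower.basis_repr_apply, exteriorPower.ιMultiDual_apply_ιMulti]
  congr 1

theorem wedge_enum (s : Set.powersetCard (Fin d) j) :
    wedge (fun i => EuclideanSpace.single (enum s i) (1 : K)) = EuclideanSpace.single s 1 := by
  ext t
  have : wedge (fun i => EuclideanSpace.single (enum s i) (1 : K)) t =
      (((EuclideanSpace.basisFun (Fin d) K).toBasis.exteriorPower j).repr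
      (exteriorPower.ιMulti_family K j (EuclideanSpace.basisFun (Fin d) K).toBasis s)) t := by
    have : (fun i => EuclideanSpace.single (enum s i) (1 : K)) =
        (EuclideanSpace.basisFun (Fin d) K).toBasis ∘ enum s := by
      ext i; simp
    rw [this]; rfl
  rw [this, exteriorPower.basis_repr]
  simp [Finsupp.single_apply, eq_comm]

/-- The `j`-th exterior power of a linear map, in coordinates. -/
noncomputable def compound (j : ℕ) (T : EuclideanSpace K (Fin d) →ₗ[K] EuclideanSpace K (Fin d)) :
    EuclideanSpace K (Set.powersetCard (Fin d) j) →ₗ[K]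
      EuclideanSpace K (Set.powersetCard (Fin d) j) :=
  (wedgeCoord j).toLinearMap ∘ₗ exteriorPower.map j T ∘ₗ (wedgeCoord j).symm.toLinearMap

theorem compound_wedge (T : EuclideanSpace K (Fin d) →ₗ[K] EuclideanSpace K (Fin d))
    (b : Fin j → EuclideanSpace K (Fin d)) :
    compound j T (wedge b) = wedge (fun i => T (b i)) := by
  simp only [compound, wedge, LinearMap.comp_apply, LinearEquiv.coe_coe,
    LinearEquiv.symm_apply_apply, exteriorPower.map_apply_ιMulti]
  rfl

theorem compound_comp (S T : EuclideanSpace K (Fin d) →ₗ[K] EuclideanSpace K (Fin d))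
    (x : EuclideanSpace K (Set.powersetCard (Fin d) j)) :
    compound j (S ∘ₗ T) x = compound j S (compound j T x) := by
  simp only [compound, LinearMap.comp_apply, LinearEquiv.coe_coe, LinearEquiv.symm_apply_apply]
  rw [← LinearMap.comp_apply (exteriorPower.map j S), exteriorPower.map_comp]

theorem compound_id (x : EuclideanSpace K (Set.powersetCard (Fin d) j)) :
    compound j LinearMap.id x = x := by
  simp [compound]

theorem compound_ext {f g : EuclideanSpace K (Set.powersetCard (Fin d) j) →ₗ[K]
      EuclideanSpace K (Set.powersetCard (Fin d) j)}
    (h : ∀ s, f (EuclideanSpace.single s 1) = g (EuclideanSpace.single s 1)) : f = g :=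
  (EuclideanSpace.basisFun _ K).toBasis.ext fun s => by simpa using h s

theorem compound_single (A : Matrix (Fin d) (Fin d) K) (s t : Set.powersetCard (Fin d) j) :
    compound j (Matrix.toEuclideanLin A) (EuclideanSpace.single s 1) t
      = (A.submatrix (enum t) (enum s)).det := by
  rw [← wedge_enum, compound_wedge, wedge_apply, ← Matrix.det_transpose]
  congr 1
  ext a b
  simp [Matrix.toLpLin_apply]

/-- The entries of the compound are minors, and these are conjugated and transposed along with the
matrix. Together with multiplicativity this makes compounds of unitary matrices unitary, so they
preserve Plücker angles. -/
theorem compound_adjoint (A : Matrix (Fin d) (Fin d) K) :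
    LinearMap.adjoint (compound j (Matrix.toEuclideanLin A))
      = compound j (Matrix.toEuclideanLin A.conjTranspose) := by
  refine compound_ext fun s => ?_
  ext t
  rw [compound_single]
  have h : inner K (EuclideanSpace.single t (1 : K))
      (LinearMap.adjoint (compound j (Matrix.toEuclideanLin A)) (EuclideanSpace.single s 1))
      = starRingEnd K (compound j (Matrix.toEuclideanLin A) (EuclideanSpace.single t 1) s) := by
    rw [LinearMap.adjoint_inner_right, EuclideanSpace.inner_single_right, one_mul]
  rw [EuclideanSpace.inner_single_left, map_one, one_mul] at h
  rw [h, compound_single, ← Matrix.conjTranspose_submatrix, Matrix.det_conjTranspose]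
  rfl

theorem compound_mul (A B : Matrix (Fin d) (Fin d) K)
    (x : EuclideanSpace K (Set.powersetCard (Fin d) j)) :
    compound j (Matrix.toEuclideanLin (A * B)) x
      = compound j (Matrix.toEuclideanLin A) (compound j (Matrix.toEuclideanLin B) x) := by
  rw [Matrix.toLpLin_mul_same, compound_comp]

theorem compound_one (x : EuclideanSpace K (Set.powersetCard (Fin d) j)) :
    compound j (Matrix.toEuclideanLin (1 : Matrix (Fin d) (Fin d) K)) x = x := by
  rw [Matrix.toLpLin_one, compound_id]

theorem inner_compound_unitary (L : Matrix.unitaryGroup (Fin d) K)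
    (x y : EuclideanSpace K (Set.powersetCard (Fin d) j)) :
    inner K (compound j (Matrix.toEuclideanLin L.1) x) (compound j (Matrix.toEuclideanLin L.1) y)
      = inner K x y := by
  rw [← LinearMap.adjoint_inner_right, compound_adjoint, ← compound_mul,
    ← Matrix.star_eq_conjTranspose, Matrix.UnitaryGroup.star_mul_self, compound_one]

theorem norm_compound_unitary (L : Matrix.unitaryGroup (Fin d) K)
    (x : EuclideanSpace K (Set.powersetCard (Fin d) j)) :
    ‖compound j (Matrix.toEuclideanLin L.1) x‖ = ‖x‖ := by
  rw [@norm_eq_sqrt_re_inner K, @norm_eq_sqrt_re_inner K, inner_compound_unitary]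

theorem lineAngle_compound_unitary (L : Matrix.unitaryGroup (Fin d) K)
    (x y : EuclideanSpace K (Set.powersetCard (Fin d) j)) :
    lineAngle (K := K) (compound j (Matrix.toEuclideanLin L.1) x)
      (compound j (Matrix.toEuclideanLin L.1) y) = lineAngle (K := K) x y := by
  simp only [lineAngle, inner_compound_unitary, norm_compound_unitary]

theorem compound_diagonal (D : Fin d → K) (x : EuclideanSpace K (Set.powersetCard (Fin d) j))
    (s : Set.powersetCard (Fin d) j) :
    compound j (Matrix.toEuclideanLin (Matrix.diagonal D)) x s = (∏ i, D (enum s i)) * x s := by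
  let f : EuclideanSpace K (Set.powersetCard (Fin d) j) →ₗ[K]
      EuclideanSpace K (Set.powersetCard (Fin d) j) :=
    Matrix.toEuclideanLin (Matrix.diagonal fun s => ∏ i, D (enum s i))
  have hf : compound j (Matrix.toEuclideanLin (Matrix.diagonal D)) = f := by
    refine compound_ext fun t => ?_
    have h1 : (fun i => Matrix.toEuclideanLin (Matrix.diagonal D)
        (EuclideanSpace.single (enum t i) (1 : K)))
        = fun i => D (enum t i) • EuclideanSpace.single (enum t i) (1 : K) := by
      ext i a
      simp [Matrix.toLpLin_apply]
    have h2 : compound j (Matrix.toEuclideanLin (Matrix.diagonal D)) (EuclideanSpace.single t 1)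
        = (∏ i, D (enum t i)) • EuclideanSpace.single t (1 : K) := by
      rw [← wedge_enum, compound_wedge, h1]
      unfold wedge
      rw [(exteriorPower.ιMulti K j).map_smul_univ, map_smul]
    rw [h2]
    ext a
    simp [f, Matrix.toLpLin_apply]
  rw [hf]
  simp [f, Matrix.toLpLin_apply, Matrix.mulVec_diagonal]

/-! ### Plücker vectors -/

/-- Any spanning family of `j` vectors computes the Plücker line. -/
theorem Gr.exists_wedge_eq_smul (V : Gr K d j) (b : Fin j → EuclideanSpace K (Fin d))
    (hb : Submodule.span K (Set.range b) = V.carrier) :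
    ∃ r : K, r ≠ 0 ∧ wedge b = r • V.plucker := by
  have hmem : ∀ i, b i ∈ V.carrier := fun i => hb ▸ Submodule.subset_span ⟨i, rfl⟩
  let c : Fin j → V.carrier := fun i => ⟨b i, hmem i⟩
  have hc : ⊤ ≤ Submodule.span K (Set.range c) := by
    refine (Submodule.map_injective_of_injective V.carrier.injective_subtype ?_).ge
    rw [Submodule.map_top, Submodule.range_subtype, Submodule.map_span, ← Set.range_comp]
    exact hb
  have hli := linearIndependent_of_top_le_span_of_card_eq_finrank hc (by simp [V.finrank_eq])
  have hu := (V.basis.is_basis_iff_det (v := c)).1 ⟨hli, top_le_iff.1 hc⟩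
  refine ⟨V.basis.det c, hu.ne_zero, ?_⟩
  ext s
  -- A single coordinate of the wedge is an alternating form. Restricted to `V` it is a multiple of
  -- the determinant in `V.basis`, so the proportionality factor `V.basis.det c` is the same for all
  -- coordinates.
  let φ : EuclideanSpace K (Fin d) [⋀^Fin j]→ₗ[K] K :=
    ((LinearMap.proj s ∘ₗ (WithLp.linearEquiv 2 K _).toLinearMap) ∘ₗ
      (wedgeCoord j).toLinearMap).compAlternatingMap (exteriorPower.ιMulti K j)
  have h := congrArg (fun f => f c)
    ((φ.compLinearMap V.carrier.subtype).eq_smul_basis_det V.basis)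
  change φ b = φ (fun i => V.basis i) • V.basis.det c at h
  rw [smul_eq_mul, mul_comm] at h
  exact h

theorem Gr.span_basis (V : Gr K d j) :
    Submodule.span K (Set.range fun i => (V.basis i : EuclideanSpace K (Fin d))) = V.carrier := by
  have : (Set.range fun i => (V.basis i : EuclideanSpace K (Fin d)))
      = V.carrier.subtype '' Set.range V.basis := by
    rw [← Set.range_comp]; rfl
  rw [this, Submodule.span_image, V.basis.span_eq, Submodule.map_top, Submodule.range_subtype]

theorem Gr.exists_compound_eq_smul (V W : Gr K d j)
    (T : EuclideanSpace K (Fin d) →ₗ[K] EuclideanSpace K (Fin d))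
    (h : W.carrier = V.carrier.map T) :
    ∃ r : K, r ≠ 0 ∧ compound j T V.plucker = r • W.plucker := by
  have : compound j T V.plucker = wedge (fun i => T (V.basis i)) := compound_wedge T _
  rw [this]
  refine W.exists_wedge_eq_smul _ ?_
  rw [h, ← congrArg (Submodule.map T) V.span_basis, Submodule.map_span, ← Set.range_comp]
  rfl

theorem Gr.dist_eq (V W : Gr K d j) :
    dist V W = lineAngle (K := K) V.plucker W.plucker := rfl

theorem Gr.dist_eq_of_smul {V W : Gr K d j} {x y : EuclideanSpace K (Set.powersetCard (Fin d) j)}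
    (hx : ∃ r : K, r ≠ 0 ∧ x = r • V.plucker) (hy : ∃ r : K, r ≠ 0 ∧ y = r • W.plucker) :
    dist V W = lineAngle (K := K) x y := by
  obtain ⟨r, hr, rfl⟩ := hx
  obtain ⟨t, ht, rfl⟩ := hy
  rw [lineAngle_smul_left _ _ hr, lineAngle_comm, lineAngle_smul_left _ _ ht, lineAngle_comm]
  rfl

/-! ### Coordinate subspaces and their unitary images -/

/-- The set `{0, …, j - 1}`. -/
def initSet (hj : j ≤ d) : Set.powersetCard (Fin d) j :=
  Set.powersetCard.ofFinEmbEquiv (Fin.castLEOrderEmb hj)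

theorem enum_initSet (hj : j ≤ d) (i : Fin j) : enum (initSet hj) i = Fin.castLE hj i := by
  simp [enum, initSet]

theorem inner_unitary (L : Matrix.unitaryGroup (Fin d) K) (x y : EuclideanSpace K (Fin d)) :
    inner K (Matrix.toEuclideanLin L.1 x) (Matrix.toEuclideanLin L.1 y) = inner K x y := by
  rw [← LinearMap.adjoint_inner_right, ← Matrix.toEuclideanLin_conjTranspose_eq_adjoint,
    ← LinearMap.comp_apply, ← Matrix.toLpLin_mul_same,
    ← Matrix.star_eq_conjTranspose, Matrix.UnitaryGroup.star_mul_self, Matrix.toLpLin_one,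
    LinearMap.id_apply]

/-- The span of the first `j` columns of a unitary matrix. -/
noncomputable def frame (L : Matrix.unitaryGroup (Fin d) K) (hj : j ≤ d) : Gr K d j where
  carrier := Submodule.span K
    (Set.range fun i : Fin j => Matrix.toEuclideanLin L.1
      (EuclideanSpace.single (Fin.castLE hj i) (1 : K)))
  finrank_eq := by
    rw [finrank_span_eq_card, Fintype.card_fin]
    refine Orthonormal.linearIndependent (orthonormal_iff_ite.2 fun a b => ?_)
    rw [inner_unitary, EuclideanSpace.inner_single_left]
    simp

theorem frame_carrier (L : Matrix.unitaryGroup (Fin d) K) (hj : j ≤ d) :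
    (frame L hj).carrier = Submodule.span K
      ((fun i : Fin d => Matrix.toEuclideanLin L.1 (EuclideanSpace.single i (1 : K))) ''
        {i | (i : ℕ) < j}) := by
  refine congrArg (Submodule.span K) (Set.ext fun x => ⟨?_, ?_⟩)
  · rintro ⟨i, rfl⟩
    exact ⟨Fin.castLE hj i, i.2, rfl⟩
  · rintro ⟨i, hi, rfl⟩
    exact ⟨⟨i, hi⟩, rfl⟩

theorem frame_plucker (L : Matrix.unitaryGroup (Fin d) K) (hj : j ≤ d) :
    ∃ r : K, r ≠ 0 ∧ compound j (Matrix.toEuclideanLin L.1)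
      (EuclideanSpace.single (initSet hj) 1) = r • (frame L hj).plucker := by
  rw [← wedge_enum, compound_wedge]
  refine (frame L hj).exists_wedge_eq_smul _ ?_
  simp only [enum_initSet]
  rfl

/-- The cosine of the distance to `frame L hj` is a normalised Plücker coordinate. -/
theorem dist_frame_inv (V : Gr K d j) (M : Matrix.unitaryGroup (Fin d) K) (hj : j ≤ d) :
    dist V (frame M⁻¹ hj) = lineAngle (K := K) (compound j (Matrix.toEuclideanLin M.1) V.plucker)
      (EuclideanSpace.single (initSet hj) 1) := by
  rw [Gr.dist_eq_of_smul ⟨1, one_ne_zero, (one_smul K _).symm⟩ (frame_plucker M⁻¹ hj),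
    ← lineAngle_compound_unitary M, ← compound_mul]
  have : M.1 * (M⁻¹).1 = 1 := congrArg Subtype.val (mul_inv_cancel M)
  rw [this, compound_one]

theorem lineAngle_single {ι : Type*} [Fintype ι] [DecidableEq ι] (y : EuclideanSpace K ι) (s : ι) :
    lineAngle (K := K) y (EuclideanSpace.single s 1) = Real.arccos (‖y s‖ / ‖y‖) := by
  unfold lineAngle
  rw [EuclideanSpace.inner_single_right, one_mul, RCLike.norm_conj]
  simp

/-- An angle is at most its tangent, which here is the norm of the remaining coordinates divided by
`‖y s‖`. -/
theorem lineAngle_single_le {ι : Type*} [Fintype ι] [DecidableEq ι] (y : EuclideanSpace K ι)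
    (s : ι) {B : ℝ} (hB : 0 ≤ B) (hy : y s ≠ 0)
    (h : ∑ t ∈ Finset.univ.erase s, ‖y t‖ ^ 2 ≤ B ^ 2) :
    lineAngle (K := K) y (EuclideanSpace.single s 1) ≤ B / ‖y s‖ := by
  have hs : 0 < ‖y s‖ := norm_pos_iff.2 hy
  have hn : ‖y‖ ^ 2 = ‖y s‖ ^ 2 + ∑ t ∈ Finset.univ.erase s, ‖y t‖ ^ 2 := by
    rw [EuclideanSpace.norm_sq_eq,
      Finset.add_sum_erase _ (fun t => ‖y t‖ ^ 2) (Finset.mem_univ s)]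
  have hy0 : 0 < ‖y‖ := by
    rw [norm_pos_iff]; rintro rfl; simp at hy
  have hx : 0 < ‖y s‖ / ‖y‖ := div_pos hs hy0
  rw [lineAngle_single, Real.arccos_eq_arctan hx]
  have h1 : √(1 - (‖y s‖ / ‖y‖) ^ 2) / (‖y s‖ / ‖y‖) ≤ B / ‖y s‖ := by
    have h2 : 1 - (‖y s‖ / ‖y‖) ^ 2 ≤ (B / ‖y‖) ^ 2 := by
      rw [div_pow, div_pow, sub_le_iff_le_add, ← add_div, le_div_iff₀ (by positivity)]
      linarith
    calc √(1 - (‖y s‖ / ‖y‖) ^ 2) / (‖y s‖ / ‖y‖) ≤ (B / ‖y‖) / (‖y s‖ / ‖y‖) := by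
          gcongr
          exact Real.sqrt_le_iff.2 ⟨by positivity, h2⟩
      _ = B / ‖y s‖ := by field_simp
  refine le_trans ?_ h1
  set t := √(1 - (‖y s‖ / ‖y‖) ^ 2) / (‖y s‖ / ‖y‖) with ht
  have ht0 : 0 ≤ t := by positivity
  calc Real.arctan t ≤ Real.tan (Real.arctan t) :=
        Real.le_tan (Real.arctan_nonneg.2 ht0) (Real.arctan_lt_pi_div_two t)
    _ = t := Real.tan_arctan t

/-! ### Contraction -/

theorem strictMono_add_le {f : Fin j → Fin d} (hf : StrictMono f) (a n : ℕ) (ha : a + n < j) :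
    (f ⟨a, by omega⟩ : ℕ) + n ≤ f ⟨a + n, ha⟩ := by
  induction n with
  | zero => simp
  | succ n ih =>
    have h1 := ih (by omega)
    have h2 : f ⟨a + n, by omega⟩ < f ⟨a + (n + 1), ha⟩ := hf (by simp)
    rw [Fin.lt_def] at h2
    omega

/-- Compare term by term: the `i`-th element of `s` is at least `i`, and `A` decreases. A set other
than the initial one has largest element at least `j` (counting from `0`), so the last term alone
loses `α_j`. -/
theorem sum_enum_le {A : Fin d → ℝ} (hA : Antitone A) (h1 : 1 ≤ j) (hjd : j < d)
    {s : Set.powersetCard (Fin d) j} (hs : s ≠ initSet hjd.le) :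
    ∑ i, A (enum s i) ≤ ∑ i, A (enum (initSet hjd.le) i) - simpleRoot j A := by
  obtain ⟨m, rfl⟩ : ∃ m, j = m + 1 := ⟨j - 1, by omega⟩
  have hmono : StrictMono (enum s) := (enum s).strictMono
  have hge : ∀ i : Fin (m + 1), (i : ℕ) ≤ enum s i := fun i => by
    have := strictMono_add_le hmono 0 i (by omega)
    simp only [zero_add, Fin.eta] at this
    omega
  have hlast : m + 1 ≤ (enum s (Fin.last m) : ℕ) := by
    by_contra hlt
    apply hs
    have : enum s = Fin.castLEOrderEmb hjd.le := by
      ext i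
      -- From the `i`-th element to the last there are `m - i` strict increases, so a last element
      -- at most `m` forces the `i`-th to be at most `i`, hence equal to `i`.
      have h2 := strictMono_add_le hmono i (m - i) (by omega)
      have h3 : (⟨(i : ℕ) + (m - i), by omega⟩ : Fin (m + 1)) = Fin.last m := by
        ext; simp; omega
      rw [h3] at h2
      have := hge i
      simp only [Fin.eta] at h2
      simp
      omega
    unfold initSet
    rw [← this, Equiv.apply_symm_apply]
  have hroot : simpleRoot (m + 1) A = A ⟨m, by omega⟩ - A ⟨m + 1, hjd⟩ := by
    simp [simpleRoot, hjd]
  rw [Fin.sum_univ_castSucc, Fin.sum_univ_castSucc, hroot, enum_initSet]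
  have e1 : ∑ i : Fin m, A (enum s i.castSucc)
      ≤ ∑ i : Fin m, A (enum (initSet hjd.le) i.castSucc) := by
    refine Finset.sum_le_sum fun i _ => hA ?_
    rw [enum_initSet]
    exact hge i.castSucc
  have e2 : A (enum s (Fin.last m)) ≤ A ⟨m + 1, hjd⟩ := hA hlast
  have e3 : Fin.castLE hjd.le (Fin.last m) = ⟨m, by omega⟩ := rfl
  rw [e3]
  linarith

theorem cos_dist_frame_inv (V : Gr K d j) (M : Matrix.unitaryGroup (Fin d) K) (hj : j ≤ d) :
    Real.cos (dist V (frame M⁻¹ hj))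
      = ‖compound j (Matrix.toEuclideanLin M.1) V.plucker (initSet hj)‖ / ‖V.plucker‖ := by
  rw [dist_frame_inv, lineAngle_single, norm_compound_unitary, Real.cos_arccos]
  · exact le_trans (by norm_num) (div_nonneg (norm_nonneg _) (norm_nonneg _))
  · refine div_le_one_of_le₀ ?_ (norm_nonneg _)
    rw [← norm_compound_unitary M]
    exact PiLp.norm_apply_le _ _

/-- A linear map with Cartan decomposition `L exp(A) M` contracts the subspaces in general position
with respect to the orthogonal complement of `frame M⁻¹ hj` towards `frame L hj`. -/
theorem dist_frame_le (L M : Matrix.unitaryGroup (Fin d) K) {A : Fin d → ℝ} (hA : Antitone A)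
    (h1 : 1 ≤ j) (hjd : j < d) (V W : Gr K d j)
    (hW : W.carrier = V.carrier.map (Matrix.toEuclideanLin
      (L.1 * Matrix.diagonal (fun i => ((Real.exp (A i) : ℝ) : K)) * M.1)))
    (hV : dist V (frame M⁻¹ hjd.le) < Real.pi / 2) :
    dist W (frame L hjd.le)
      ≤ Real.exp (-simpleRoot j A) / Real.cos (dist V (frame M⁻¹ hjd.le)) := by
  set s := initSet hjd.le with hs
  set w := compound j (Matrix.toEuclideanLin M.1) V.plucker with hw
  set y := compound j (Matrix.toEuclideanLin
    (Matrix.diagonal fun i => ((Real.exp (A i) : ℝ) : K))) w with hy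
  have hN : ‖w‖ = ‖V.plucker‖ := norm_compound_unitary _ _
  have hNpos : 0 < ‖V.plucker‖ := norm_pos_iff.2 V.plucker_ne_zero
  have hws : 0 < ‖w s‖ := by
    rw [dist_frame_inv, lineAngle_single, Real.arccos_lt_pi_div_two] at hV
    by_contra h
    rw [le_antisymm (not_lt.1 h) (norm_nonneg _), zero_div] at hV
    exact hV.false
  have hyt : ∀ t, ‖y t‖ = Real.exp (∑ i, A (enum t i)) * ‖w t‖ := fun t => by
    rw [hy, compound_diagonal, norm_mul, norm_prod, Real.exp_sum]
    simp
  have hys : y s ≠ 0 := by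
    rw [← norm_pos_iff, hyt]; positivity
  have hdist : dist W (frame L hjd.le) = lineAngle (K := K) y (EuclideanSpace.single s 1) := by
    rw [Gr.dist_eq_of_smul (V.exists_compound_eq_smul W _ hW) (frame_plucker L hjd.le),
      mul_assoc, compound_mul, compound_mul, lineAngle_compound_unitary]
  rw [hdist, cos_dist_frame_inv, ← hN]
  -- The other coordinates of `w` are bounded together by `‖w‖`. Dividing by `‖w s‖` later produces
  -- the reciprocal of the cosine.
  have hB : ∑ t ∈ Finset.univ.erase s, ‖y t‖ ^ 2
      ≤ (Real.exp (∑ i, A (enum s i) - simpleRoot j A) * ‖w‖) ^ 2 := by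
    rw [mul_pow, EuclideanSpace.norm_sq_eq w, Finset.mul_sum]
    refine (Finset.sum_le_sum (g := fun t =>
      Real.exp (∑ i, A (enum s i) - simpleRoot j A) ^ 2 * ‖w t‖ ^ 2) fun t ht => ?_).trans ?_
    · rw [hyt, mul_pow]
      gcongr
      exact sum_enum_le hA h1 hjd (Finset.ne_of_mem_erase ht)
    · exact Finset.sum_le_sum_of_subset_of_nonneg (Finset.erase_subset _ _)
        fun _ _ _ => by positivity
  refine (lineAngle_single_le y s (by positivity) hys hB).trans (le_of_eq ?_)
  change _ = Real.exp (-simpleRoot j A) / (‖w s‖ / ‖w‖)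
  rw [hyt, sub_eq_add_neg, Real.exp_add]
  have := (Real.exp_pos (∑ i, A (enum s i))).ne'
  field_simp

/-! ### Transversality and continuity -/

/-- If `V` does not meet the span of the last `d - j` columns of `L`, it is at distance less than
`π / 2` from the span of the first `j` ones. -/
theorem dist_frame_lt_pi_div_two (V : Gr K d j) (L : Matrix.unitaryGroup (Fin d) K) (hj : j ≤ d)
    (h : Disjoint V.carrier (Submodule.span K
      ((fun i : Fin d => Matrix.toEuclideanLin L.1 (EuclideanSpace.single i (1 : K))) ''
        {i | j ≤ (i : ℕ)}))) :
    dist V (frame L hj) < Real.pi / 2 := by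
  rw [← inv_inv L, dist_frame_inv, lineAngle_single, Real.arccos_lt_pi_div_two]
  refine div_pos ?_ ?_
  swap
  · rw [norm_compound_unitary]; exact norm_pos_iff.2 V.plucker_ne_zero
  rw [norm_pos_iff]
  intro h0
  change compound j _ (wedge _) _ = 0 at h0
  rw [compound_wedge, wedge_apply] at h0
  -- The initial Plücker coordinate is the determinant of the first `j` coordinates of the basis of
  -- `V` in the columns of `L`. If it vanishes, some combination `v` of the basis has these
  -- coordinates zero, so it lies in the span of the last columns.
  obtain ⟨c, hc, hc0⟩ := Matrix.exists_vecMul_eq_zero_iff.2 h0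
  let v : V.carrier := ∑ i, c i • V.basis i
  let M := L⁻¹
  have hLM : L.1 * M.1 = 1 := congrArg Subtype.val (mul_inv_cancel L)
  have hcoord : ∀ a : Fin d, (a : ℕ) < j → Matrix.toEuclideanLin M.1 v.1 a = 0 := by
    intro a ha
    have h2 := congrFun hc0 ⟨a, ha⟩
    simp only [Matrix.vecMul, dotProduct, Matrix.of_apply, enum_initSet, Pi.zero_apply] at h2
    have h3 : v.1 = ∑ i, c i • (V.basis i).1 := by simp [v]
    rw [h3, map_sum, WithLp.ofLp_sum, Finset.sum_apply, ← h2]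
    exact Finset.sum_congr rfl fun i _ => by rw [map_smul]; rfl
  have hv : v.1 = ∑ a : Fin d, Matrix.toEuclideanLin M.1 v.1 a •
      Matrix.toEuclideanLin L.1 (EuclideanSpace.single a (1 : K)) := by
    have h4 : Matrix.toEuclideanLin L.1 (Matrix.toEuclideanLin M.1 v.1) = v.1 := by
      rw [← LinearMap.comp_apply, ← Matrix.toLpLin_mul_same, hLM, Matrix.toLpLin_one,
        LinearMap.id_apply]
    conv_lhs => rw [← h4]
    have h5 := (EuclideanSpace.basisFun (Fin d) K).sum_repr (Matrix.toEuclideanLin M.1 v.1)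
    conv_lhs => rw [← h5]
    simp [map_sum, map_smul]
  have hv0 : v.1 = 0 := by
    refine Submodule.disjoint_def.1 h v.1 v.2 ?_
    rw [hv]
    refine Submodule.sum_mem _ fun a _ => ?_
    by_cases ha : (a : ℕ) < j
    · rw [hcoord a ha, zero_smul]; exact Submodule.zero_mem _
    · exact Submodule.smul_mem _ _ (Submodule.subset_span ⟨a, not_lt.1 ha, rfl⟩)
  have := Fintype.linearIndependent_iff.1 V.basis.linearIndependent c (Subtype.ext hv0)
  exact hc (funext this)

/-- The Plücker line of the frame is spanned by a unit vector whose coordinates are minors of `L`,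
so the distance to a fixed frame is continuous in `L`. -/
theorem continuous_frame (hj : j ≤ d) :
    Continuous fun L : Matrix.unitaryGroup (Fin d) K => frame L hj := by
  let e : EuclideanSpace K (Set.powersetCard (Fin d) j) := EuclideanSpace.single (initSet hj) 1
  have hc : Continuous fun L : Matrix.unitaryGroup (Fin d) K =>
      compound j (Matrix.toEuclideanLin L.1) e := by
    refine (PiLp.continuous_toLp 2 _).comp (continuous_pi fun t => ?_)
    change Continuous fun L : Matrix.unitaryGroup (Fin d) K =>
      compound j (Matrix.toEuclideanLin L.1) (EuclideanSpace.single (initSet hj) 1) t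
    simp only [compound_single]
    exact (continuous_subtype_val.matrix_submatrix _ _).matrix_det
  rw [continuous_iff_continuousAt]
  intro L₀
  rw [ContinuousAt, tendsto_iff_dist_tendsto_zero]
  have hd : ∀ L, dist (frame L hj) (frame L₀ hj) = lineAngle (K := K)
      (compound j (Matrix.toEuclideanLin L.1) e) (compound j (Matrix.toEuclideanLin L₀.1) e) :=
    fun L => Gr.dist_eq_of_smul (frame_plucker L hj) (frame_plucker L₀ hj)
  have hcont : Continuous fun L => dist (frame L hj) (frame L₀ hj) := by
    simp only [hd, lineAngle, norm_compound_unitary]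
    exact Real.continuous_arccos.comp ((hc.inner continuous_const).norm.div_const _)
  simpa using hcont.tendsto L₀

/-! ### Cartan decompositions -/

theorem adjoint_comp_toEuclideanLin (A : Matrix (Fin d) (Fin d) K) :
    LinearMap.adjoint (Matrix.toEuclideanLin A) ∘ₗ Matrix.toEuclideanLin A
      = Matrix.toEuclideanLin (A.conjTranspose * A) := by
  rw [← Matrix.toEuclideanLin_conjTranspose_eq_adjoint, Matrix.toLpLin_mul_same]

/-- Let the columns of `U` be orthonormal eigenvectors of `A* A`, with eigenvalues `σ_i²`. As no
`σ_i` vanishes, `A U diag(σ⁻¹)` makes sense, and it is unitary; it is the left factor, and `U*` is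
the right one. -/
theorem exists_singular_value_decomposition (A : Matrix (Fin d) (Fin d) K)
    (hA : ∀ i < d, 0 < (Matrix.toEuclideanLin A).singularValues i) :
    ∃ L M : Matrix.unitaryGroup (Fin d) K, A = L.1 * Matrix.diagonal
      (fun i : Fin d => (((Matrix.toEuclideanLin A).singularValues i : ℝ) : K)) * M.1 := by
  set T := Matrix.toEuclideanLin A with hT
  have hn : Module.finrank K (EuclideanSpace K (Fin d)) = d := finrank_euclideanSpace_fin
  let b := T.isSymmetric_adjoint_comp_self.eigenvectorBasis hn
  let σ : Fin d → K := fun i => ((T.singularValues i : ℝ) : K)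
  have hσ : ∀ i, σ i ≠ 0 := fun i => by
    have := (hA i i.2).ne'
    simpa [σ] using this
  let U : Matrix (Fin d) (Fin d) K := (EuclideanSpace.basisFun (Fin d) K).toBasis.toMatrix b.toBasis
  have hU : U ∈ Matrix.unitaryGroup (Fin d) K :=
    (EuclideanSpace.basisFun (Fin d) K).toMatrix_orthonormalBasis_mem_unitary b
  have hU1 : star U * U = 1 := Matrix.mem_unitaryGroup_iff'.1 hU
  have hU2 : U * star U = 1 := Matrix.mem_unitaryGroup_iff.1 hU
  have hAU : A.conjTranspose * A * U = U * Matrix.diagonal (fun i => σ i * σ i) := by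
    ext a k
    have h1 : Matrix.toEuclideanLin (A.conjTranspose * A) (b k)
        = ((T.singularValues k ^ 2 : ℝ) : K) • b k := by
      rw [← adjoint_comp_toEuclideanLin, T.sq_singularValues_fin hn]
      exact T.isSymmetric_adjoint_comp_self.apply_eigenvectorBasis hn k
    have h2 := congrFun (congrArg WithLp.ofLp h1) a
    rw [Matrix.mul_diagonal, Matrix.mul_apply]
    have h3 : ∀ i, U i k = b k i := fun i => by simp [U, Module.Basis.toMatrix_apply]
    simp only [h3]
    rw [Matrix.toLpLin_apply] at h2
    refine h2.trans ?_
    simp only [σ, PiLp.smul_apply, smul_eq_mul]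
    push_cast
    change _ * b k a = _
    ring
  let Di : Matrix (Fin d) (Fin d) K := Matrix.diagonal fun i => (σ i)⁻¹
  have hDi : star Di = Di := by
    rw [Matrix.star_eq_conjTranspose, Matrix.diagonal_conjTranspose]
    congr 1
    ext i
    simp [σ]
  have hL : A * U * Di ∈ Matrix.unitaryGroup (Fin d) K := by
    rw [Matrix.mem_unitaryGroup_iff']
    calc star (A * U * Di) * (A * U * Di)
        = Di * (star U * (A.conjTranspose * A * U)) * Di := by
          rw [star_mul, star_mul, hDi, Matrix.star_eq_conjTranspose A]
          simp only [Matrix.mul_assoc]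
      _ = 1 := by
          rw [hAU, ← Matrix.mul_assoc (star U), hU1, Matrix.one_mul]
          simp only [Di, Matrix.diagonal_mul_diagonal]
          rw [← Matrix.diagonal_one]
          congr 1
          ext i
          have := hσ i
          field_simp
  refine ⟨⟨_, hL⟩, ⟨star U, Matrix.mem_unitaryGroup_iff.2 (by rwa [star_star])⟩, ?_⟩
  have : Di * Matrix.diagonal σ = 1 := by
    simp only [Di, Matrix.diagonal_mul_diagonal]
    rw [← Matrix.diagonal_one]
    congr 1
    ext i
    exact inv_mul_cancel₀ (hσ i)
  change A = A * U * Di * Matrix.diagonal σ * star U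
  rw [Matrix.mul_assoc _ Di, this, Matrix.mul_one, Matrix.mul_assoc, hU2, Matrix.mul_one]

-- `A* A` is unitarily conjugate to `diag(σ_i²)`, so these are the roots of its characteristic
-- polynomial. Both lists are in decreasing order, hence agree entry by entry. Thus any ordered
-- decomposition determines the Cartan projection.
open Polynomial in
theorem singularValues_of_decomposition (L M : Matrix.unitaryGroup (Fin d) K) {σ : Fin d → ℝ}
    (hσ : Antitone σ) (h0 : ∀ i, 0 ≤ σ i) (i : Fin d) :
    (Matrix.toEuclideanLin
      (L.1 * Matrix.diagonal (fun i => ((σ i : ℝ) : K)) * M.1)).singularValues i = σ i := by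
  set A := L.1 * Matrix.diagonal (fun i => ((σ i : ℝ) : K)) * M.1 with hA
  set T := Matrix.toEuclideanLin A with hT
  have hn : Module.finrank K (EuclideanSpace K (Fin d)) = d := finrank_euclideanSpace_fin
  have hLL : star L.1 * L.1 = 1 := Matrix.mem_unitaryGroup_iff'.1 L.2
  have hMM : M.1 * star M.1 = 1 := Matrix.mem_unitaryGroup_iff.1 M.2
  have hstar : star (Matrix.diagonal (fun i => ((σ i : ℝ) : K)))
      = Matrix.diagonal (fun i => ((σ i : ℝ) : K)) := by
    rw [Matrix.star_eq_conjTranspose, Matrix.diagonal_conjTranspose]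
    congr 1
    ext i
    simp
  have hAA : A.conjTranspose * A
      = star M.1 * (Matrix.diagonal (fun i => ((σ i ^ 2 : ℝ) : K)) * M.1) := by
    rw [← Matrix.star_eq_conjTranspose, hA, star_mul, star_mul, hstar]
    have : Matrix.diagonal (fun i => ((σ i ^ 2 : ℝ) : K))
        = Matrix.diagonal (fun i => ((σ i : ℝ) : K)) * (star L.1 * L.1) *
          Matrix.diagonal (fun i => ((σ i : ℝ) : K)) := by
      rw [hLL, Matrix.mul_one, Matrix.diagonal_mul_diagonal]
      congr 1
      ext i
      push_cast
      ring
    rw [this]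
    simp only [Matrix.mul_assoc]
  have hchar : (LinearMap.adjoint T ∘ₗ T).charpoly = ∏ i, (X - C ((σ i ^ 2 : ℝ) : K)) := by
    have h1 : (Matrix.toEuclideanLin (A.conjTranspose * A)).charpoly
        = (A.conjTranspose * A).charpoly :=
      Matrix.charpoly_toLin _ (EuclideanSpace.basisFun (Fin d) K).toBasis
    rw [adjoint_comp_toEuclideanLin, h1, hAA,
      Matrix.charpoly_mul_comm, Matrix.mul_assoc, hMM, Matrix.mul_one, Matrix.charpoly_diagonal]
  have hroots : (LinearMap.adjoint T ∘ₗ T).charpoly.roots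
      = Multiset.map (fun i => ((σ i ^ 2 : ℝ) : K)) Finset.univ.val := by
    have h1 : ∀ τ : Fin d → K, (∏ i, (X - C (τ i))).roots = Multiset.map τ Finset.univ.val := by
      intro τ
      rw [Polynomial.roots_prod _ _ (by
        simp [Finset.prod_ne_zero_iff, Polynomial.X_sub_C_ne_zero])]
      simp
    rw [hchar, h1]
  have hsort := T.isSymmetric_adjoint_comp_self.sort_roots_charpoly_eq_eigenvalues hn
  have hanti : Antitone fun i => σ i ^ 2 := fun _ b hab =>
    pow_le_pow_left₀ (h0 b) (hσ hab) 2
  have hre : (Multiset.map (fun i => ((σ i ^ 2 : ℝ) : K)) Finset.univ.val).map RCLike.re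
      = ((List.ofFn fun i => σ i ^ 2 : List ℝ) : Multiset ℝ) := by
    rw [Multiset.map_map, ← Fin.univ_val_map]
    refine Multiset.map_congr rfl fun i _ => ?_
    simp only [Function.comp_apply, RCLike.ofReal_re]
  rw [hroots, hre, Multiset.coe_sort, List.mergeSort_of_pairwise] at hsort
  · have h2 := congrFun (List.ofFn_injective hsort) i
    have h3 : T.singularValues i ^ 2 = σ i ^ 2 := by
      rw [T.sq_singularValues_fin hn, ← h2]
    exact (pow_left_inj₀ (T.singularValues_nonneg _) (h0 i) two_ne_zero).1 h3
  · simp_rw [decide_eq_true_eq, ← List.sortedGE_iff_pairwise]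
    exact hanti.sortedGE_ofFn

theorem singularValues_repLin_pos (g : PGL(d, K)) (i : Fin d) :
    0 < (repLin g).singularValues i :=
  (repLin g).injective_iff_forall_lt_finrank_singularValues_pos.1 (repLin_injective g) i
    (by simp)

theorem exp_cartan (g : PGL(d, K)) (i : Fin d) :
    Real.exp (cartan g i) = (repLin g).singularValues i :=
  Real.exp_log (singularValues_repLin_pos g i)

theorem cartan_antitone (g : PGL(d, K)) : Antitone (cartan g) := fun _ b hab =>
  Real.log_le_log (singularValues_repLin_pos g b) ((repLin g).singularValues_antitone hab)

/-- The matrix `L exp(A) M`. -/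
noncomputable def cartanMatrix (L : Matrix.unitaryGroup (Fin d) K) (A : Fin d → ℝ)
    (M : Matrix.unitaryGroup (Fin d) K) : Matrix (Fin d) (Fin d) K :=
  L.1 * Matrix.diagonal (fun i => ((Real.exp (A i) : ℝ) : K)) * M.1

theorem exists_cartanMatrix_eq (g : PGL(d, K)) :
    ∃ L M : Matrix.unitaryGroup (Fin d) K, (rep g).1 = cartanMatrix L (cartan g) M := by
  simp only [cartanMatrix, exp_cartan]
  exact exists_singular_value_decomposition _ fun i hi => singularValues_repLin_pos g ⟨i, hi⟩

theorem cartan_eq_of_rep_eq {g : PGL(d, K)} {L M : Matrix.unitaryGroup (Fin d) K} {A : Fin d → ℝ}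
    (hA : Antitone A) (h : (rep g).1 = cartanMatrix L A M) : cartan g = A := by
  ext i
  have := singularValues_of_decomposition L M (σ := fun i => Real.exp (A i))
    (fun _ _ hab => Real.exp_le_exp.2 (hA hab)) (fun _ => (Real.exp_pos _).le) i
  rw [cartan, repLin, h, cartanMatrix, this, Real.log_exp]

/-! ### Inverses -/

/-- Two representatives differ by a scalar `c`, and comparing determinants gives `‖c‖ ^ d = 1`. -/
theorem exists_rep_inv (hd : 0 < d) (g : PGL(d, K)) :
    ∃ c : K, ‖c‖ = 1 ∧ (rep g⁻¹).1 = c • ((rep g)⁻¹).1 := by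
  have h : Matrix.ProjGenLinGroup.mk (rep g)⁻¹ = Matrix.ProjGenLinGroup.mk (rep g⁻¹) := by
    rw [map_inv, mk_rep, mk_rep]
  obtain ⟨u, hu⟩ := Matrix.ProjGenLinGroup.mk_eq_mk_iff.1 h
  have hu' : (rep g⁻¹).1 = (u : K) • ((rep g)⁻¹).1 := by
    rw [← hu]
    ext a b
    simp [Matrix.GeneralLinearGroup.scalar, mul_comm]
  refine ⟨u, ?_, hu'⟩
  have h1 := norm_det_rep g⁻¹
  have h2 : ((rep g)⁻¹).1.det * (rep g).1.det = 1 := by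
    rw [← Matrix.det_mul, (rep g).inv_mul, Matrix.det_one]
  have h3 : ‖((rep g)⁻¹).1.det‖ = 1 := by
    have := congrArg norm h2
    rwa [norm_mul, norm_det_rep, mul_one, norm_one] at this
  rw [hu', Matrix.det_smul, norm_mul, norm_pow, h3, mul_one, Fintype.card_fin] at h1
  exact (pow_eq_one_iff_of_nonneg (norm_nonneg _) hd.ne').1 h1

/-- The permutation matrix reversing the order of the standard basis. -/
def reversal : Matrix.unitaryGroup (Fin d) K :=
  ⟨(1 : Matrix (Fin d) (Fin d) K).submatrix Fin.rev id, by
    rw [Matrix.mem_unitaryGroup_iff, Matrix.star_eq_conjTranspose, Matrix.conjTranspose_submatrix,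
      ← Matrix.submatrix_mul _ _ _ _ _ Function.bijective_id, Matrix.conjTranspose_one,
      Matrix.one_mul, Matrix.submatrix_one _ Fin.rev_injective]⟩

theorem reversal_mul_diagonal_mul (D : Fin d → K) :
    (reversal : Matrix.unitaryGroup (Fin d) K).1 * Matrix.diagonal (fun i => D i.rev) *
      (reversal : Matrix.unitaryGroup (Fin d) K).1 = Matrix.diagonal D := by
  ext a b
  rw [Matrix.mul_apply]
  simp only [reversal, Matrix.mul_diagonal, Matrix.submatrix_apply, Matrix.one_apply, id]
  rw [Finset.sum_eq_single a.rev]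
  · simp [Matrix.diagonal_apply]
  · intro c _ hc
    simp [hc.symm]
  · simp

theorem reversal_inv :
    (reversal : Matrix.unitaryGroup (Fin d) K)⁻¹ = reversal := by
  apply Subtype.ext
  change star ((1 : Matrix (Fin d) (Fin d) K).submatrix Fin.rev id) = _
  ext a b
  simp only [reversal, Matrix.star_apply, Matrix.submatrix_apply, Matrix.one_apply, id, apply_ite star,
    star_one, star_zero]
  exact if_congr (Fin.rev_eq_iff.trans eq_comm) rfl rfl

theorem toEuclideanLin_reversal_single (i : Fin d) :
    Matrix.toEuclideanLin (reversal : Matrix.unitaryGroup (Fin d) K).1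
      (EuclideanSpace.single i 1) = EuclideanSpace.single i.rev 1 := by
  ext a
  simp [Matrix.toLpLin_apply, reversal, Matrix.one_apply, Fin.rev_eq_iff]

theorem frame_mul_reversal_carrier (L : Matrix.unitaryGroup (Fin d) K)
    {i : ℕ} (hi : i ≤ d) (hij : j + i = d) :
    (frame (L * reversal) hi).carrier = Submodule.span K
      ((fun i : Fin d => Matrix.toEuclideanLin L.1 (EuclideanSpace.single i (1 : K))) ''
        {a | j ≤ (a : ℕ)}) := by
  rw [frame_carrier]
  have : ∀ a : Fin d, Matrix.toEuclideanLin (L * reversal).1 (EuclideanSpace.single a (1 : K))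
      = Matrix.toEuclideanLin L.1 (EuclideanSpace.single a.rev (1 : K)) := fun a => by
    rw [← toEuclideanLin_reversal_single, ← LinearMap.comp_apply, ← Matrix.toLpLin_mul_same]
    rfl
  simp only [this]
  refine congrArg (Submodule.span K) (Set.ext fun x => ⟨?_, ?_⟩)
  · rintro ⟨a, ha, rfl⟩
    refine ⟨a.rev, ?_, rfl⟩
    simp only [Set.mem_ofPred_eq, Fin.val_rev] at ha ⊢
    omega
  · rintro ⟨a, ha, rfl⟩
    refine ⟨a.rev, ?_, by simp only [Fin.rev_rev]⟩
    simp only [Set.mem_ofPred_eq, Fin.val_rev] at ha ⊢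
    omega

theorem frame_eq_of_smul {L L' : Matrix.unitaryGroup (Fin d) K} {c : K} (hc : c ≠ 0)
    (h : L'.1 = c • L.1) (hj : j ≤ d) : frame L' hj = frame L hj := by
  apply Gr.ext
  refine Eq.trans (congrArg (Submodule.span K) ?_) (Submodule.span_smul_eq_of_isUnit (Set.range
    fun i : Fin j => Matrix.toEuclideanLin L.1 (EuclideanSpace.single (Fin.castLE hj i) (1 : K)))
    c hc.isUnit)
  rw [h]
  ext x
  simp [Set.mem_smul_set]

/-- The inverse `M⁻¹ exp(-κ) L⁻¹` has its diagonal in increasing order, and `reversal` restores the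
decreasing one. The phase between the two representatives is absorbed into `L'`, which does not
change its frames. So the attracting planes of `g⁻¹` are spanned by the last columns of `M⁻¹`: they
are the repelling planes of `g`. -/
theorem exists_cartanMatrix_inv (hd : 0 < d) {g : PGL(d, K)} {L M : Matrix.unitaryGroup (Fin d) K}
    (h : (rep g).1 = cartanMatrix L (cartan g) M) :
    ∃ L' : Matrix.unitaryGroup (Fin d) K,
      (∀ {j : ℕ} (hj : j ≤ d), frame L' hj = frame (M⁻¹ * reversal) hj) ∧
      (rep g⁻¹).1 = cartanMatrix L' (fun i => -cartan g i.rev) (reversal * L⁻¹) := by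
  obtain ⟨c, hc, hrep⟩ := exists_rep_inv hd g
  have hc0 : c ≠ 0 := by rintro rfl; simp at hc
  have hcc : star c * c = 1 := by
    rw [RCLike.star_def, RCLike.conj_mul, hc]; simp
  let N := M⁻¹ * reversal
  let L' : Matrix.unitaryGroup (Fin d) K := ⟨c • N.1, by
    rw [Matrix.mem_unitaryGroup_iff', star_smul, Matrix.smul_mul, Matrix.mul_smul, smul_smul, hcc,
      one_smul]
    exact Matrix.mem_unitaryGroup_iff'.1 N.2⟩
  refine ⟨L', fun hj => frame_eq_of_smul hc0 rfl hj, ?_⟩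
  rw [hrep]
  have hinv : ((rep g)⁻¹).1 = N.1 * Matrix.diagonal
      (fun i => ((Real.exp (-cartan g i.rev) : ℝ) : K)) * (reversal * L⁻¹).1 := by
    have hN : N.1 = (M⁻¹).1 * reversal.1 := rfl
    have hR : (reversal * L⁻¹ : Matrix.unitaryGroup (Fin d) K).1
      = reversal.1 * (L⁻¹).1 := rfl
    have hD := reversal_mul_diagonal_mul (K := K)
      (fun i : Fin d => ((Real.exp (-cartan g i) : ℝ) : K))
    have e : N.1 * Matrix.diagonal
        (fun i => ((Real.exp (-cartan g i.rev) : ℝ) : K)) * (reversal * L⁻¹).1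
        = (M⁻¹).1 * Matrix.diagonal (fun i : Fin d => ((Real.exp (-cartan g i) : ℝ) : K))
          * (L⁻¹).1 := by
      rw [hN, hR, ← hD]
      simp only [Matrix.mul_assoc]
    rw [e]
    have h1 : (M⁻¹).1 * Matrix.diagonal (fun i : Fin d => ((Real.exp (-cartan g i) : ℝ) : K))
          * (L⁻¹).1 * (rep g).1 = 1 := by
      have hL : (L⁻¹).1 * L.1 = 1 := congrArg Subtype.val (inv_mul_cancel L)
      have hM : (M⁻¹).1 * M.1 = 1 := congrArg Subtype.val (inv_mul_cancel M)
      have hDD : Matrix.diagonal (fun i : Fin d => ((Real.exp (-cartan g i) : ℝ) : K)) *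
          Matrix.diagonal (fun i : Fin d => ((Real.exp (cartan g i) : ℝ) : K)) = 1 := by
        rw [Matrix.diagonal_mul_diagonal, ← Matrix.diagonal_one]
        congr 1
        ext i
        rw [← RCLike.ofReal_mul, ← Real.exp_add, neg_add_cancel, Real.exp_zero, RCLike.ofReal_one]
      rw [h, cartanMatrix]
      calc _ = (M⁻¹).1 * (Matrix.diagonal (fun i : Fin d => ((Real.exp (-cartan g i) : ℝ) : K)) *
            ((L⁻¹).1 * L.1) * Matrix.diagonal (fun i : Fin d => ((Real.exp (cartan g i) : ℝ) : K)))
            * M.1 := by simp only [Matrix.mul_assoc]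
        _ = 1 := by rw [hL, Matrix.mul_one, hDD, Matrix.mul_one, hM]
    have h2 : (rep g).1 * ((rep g)⁻¹).1 = 1 := (rep g).mul_inv
    calc ((rep g)⁻¹).1 = _ * (rep g).1 * ((rep g)⁻¹).1 := by rw [h1, Matrix.one_mul]
      _ = _ := by rw [Matrix.mul_assoc _ (rep g).1, h2, Matrix.mul_one]
  rw [hinv, cartanMatrix]
  simp only [L', Matrix.smul_mul]

theorem cartan_inv (g : PGL(d, K)) : cartan g⁻¹ = fun i => -cartan g i.rev := by
  rcases Nat.eq_zero_or_pos d with rfl | hd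
  · exact Subsingleton.elim _ _
  obtain ⟨L, M, h⟩ := exists_cartanMatrix_eq g
  obtain ⟨L', -, h'⟩ := exists_cartanMatrix_inv hd h
  exact cartan_eq_of_rep_eq
    (fun _ _ hab => neg_le_neg (cartan_antitone g (Fin.rev_le_rev.2 hab))) h'

/-- The opposition involution exchanges `α_j` and `α_{d-j}`. This is why a series in `α_k` alone
controls shadows in both components of the flag. -/
theorem simpleRoot_cartan_inv (g : PGL(d, K)) {i j : ℕ} (hi : 1 ≤ i) (hj : 1 ≤ j)
    (hij : i + j = d) : simpleRoot i (cartan g⁻¹) = simpleRoot j (cartan g) := by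
  rw [cartan_inv, simpleRoot, simpleRoot, dif_pos ⟨hi, by omega⟩, dif_pos ⟨hj, by omega⟩]
  have h1 : Fin.rev (⟨i - 1, by omega⟩ : Fin d) = ⟨j, by omega⟩ := by
    ext; simp only [Fin.val_rev]; omega
  have h2 : Fin.rev (⟨i, by omega⟩ : Fin d) = ⟨j - 1, by omega⟩ := by
    ext; simp only [Fin.val_rev]; omega
  simp only [h1, h2]
  ring

theorem actGr_inv_actGr (hd : 0 < d) (g : PGL(d, K)) (V : Gr K d j) :
    actGr g⁻¹ (actGr g V) = V := by
  obtain ⟨c, hc, h⟩ := exists_rep_inv hd g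
  have hc0 : c ≠ 0 := by rintro rfl; simp at hc
  apply Gr.ext
  change (V.carrier.map (repLin g)).map (repLin g⁻¹) = _
  have : repLin g⁻¹ ∘ₗ repLin g = c • LinearMap.id := by
    rw [repLin, repLin, h, ← Matrix.toLpLin_mul_same, Matrix.smul_mul, (rep g).inv_mul, map_smul,
      Matrix.toLpLin_one]
  rw [← Submodule.map_comp, this, Submodule.map_smul _ _ _ hc0, Submodule.map_id]

/-! ### Compactness of the unitary group -/

theorem isCompact_unitaryGroup :
    IsCompact (Matrix.unitaryGroup (Fin d) K : Set (Matrix (Fin d) (Fin d) K)) := by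
  have hcomp : IsCompact (Set.pi Set.univ fun _ : Fin d => Set.pi Set.univ fun _ : Fin d =>
      Metric.closedBall (0 : K) 1) :=
    isCompact_univ_pi fun _ => isCompact_univ_pi fun _ => isCompact_closedBall _ _
  refine hcomp.of_isClosed_subset ?_ ?_
  · have : (Matrix.unitaryGroup (Fin d) K : Set (Matrix (Fin d) (Fin d) K))
        = {U | U * star U = 1} := by
      ext U; exact Matrix.mem_unitaryGroup_iff
    rw [this]
    have hc : Continuous fun U : Matrix (Fin d) (Fin d) K => U * star U :=
      continuous_id.mul continuous_star
    exact isClosed_eq hc continuous_const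
  · intro U hU a _ b _
    simpa using entry_norm_bound_of_unitary hU a b

instance : CompactSpace (Matrix.unitaryGroup (Fin d) K) :=
  isCompact_iff_compactSpace.1 isCompact_unitaryGroup

/-- Allows convergent subsequences of Cartan factors to be extracted from compactness. -/
instance : FirstCountableTopology (Matrix.unitaryGroup (Fin d) K) :=
  haveI : FirstCountableTopology (Matrix (Fin d) (Fin d) K) :=
    inferInstanceAs (FirstCountableTopology (Fin d → Fin d → K))
  Topology.IsInducing.subtypeVal.firstCountableTopology

/-! ### Dynamics on flags -/

/-- The flag of spans of the first columns of a unitary matrix. -/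
noncomputable def frameFlag (L : Matrix.unitaryGroup (Fin d) K) (hθ : ∀ j ∈ θ, j ≤ d) :
    Flag K d θ :=
  ⟨fun j => frame L (hθ j j.2), fun i j hij => by
    rw [frame_carrier, frame_carrier]
    exact Submodule.span_mono (Set.image_mono fun a (ha : (a : ℕ) < (i : ℕ)) => lt_of_lt_of_le ha hij)⟩

theorem continuous_frameFlag (hθ : ∀ j ∈ θ, j ≤ d) :
    Continuous fun L : Matrix.unitaryGroup (Fin d) K => frameFlag L hθ :=
  Continuous.subtype_mk (continuous_pi fun j : θ => continuous_frame (hθ j j.2)) _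

theorem tendsto_flag_iff {ι : Type*} {l : Filter ι} {F : ι → Flag K d θ} {G : Flag K d θ} :
    Tendsto F l (𝓝 G) ↔ ∀ j : θ, Tendsto (fun n => (F n).1 j) l (𝓝 (G.1 j)) := by
  rw [tendsto_subtype_rng, tendsto_pi_nhds]

theorem isCartanFlag_frameFlag (hθ : ∀ j ∈ θ, j ≤ d) {g : PGL(d, K)}
    (hpos : ∀ j ∈ θ, 0 < simpleRoot j (cartan g)) {L M : Matrix.unitaryGroup (Fin d) K}
    (h : (rep g).1 = cartanMatrix L (cartan g) M) : IsCartanFlag g (frameFlag L hθ) :=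
  ⟨hpos, L.1, L.2, M.1, M.2, h, fun j => frame_carrier L (hθ j j.2)⟩

/-- Divergence makes the roots in `θ` positive from some index on, so the frames are Cartan flags
after finitely many terms are dropped. -/
theorem mem_limitSet_of_tendsto (hθ : ∀ j ∈ θ, j ≤ d) {Γ : Subgroup PGL(d, K)}
    (hΓ : ∀ j ∈ θ, IsDivergent j Γ) {γ : ℕ → PGL(d, K)} (hγ : ∀ n, γ n ∈ Γ)
    (hinj : Function.Injective γ) {L M : ℕ → Matrix.unitaryGroup (Fin d) K}
    (h : ∀ n, (rep (γ n)).1 = cartanMatrix (L n) (cartan (γ n)) (M n)) {F : Flag K d θ}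
    (hF : Tendsto (fun n => frameFlag (L n) hθ) atTop (𝓝 F)) : F ∈ limitSet θ Γ := by
  have hpos : ∀ᶠ n in atTop, ∀ j ∈ θ, 0 < simpleRoot j (cartan (γ n)) :=
    (Filter.eventually_all_finset θ).2 fun j hj => (hΓ j hj γ hγ hinj).eventually_gt_atTop 0
  obtain ⟨N, hN⟩ := eventually_atTop.1 hpos
  refine ⟨fun n => γ (n + N), fun n => frameFlag (L (n + N)) hθ, fun n => hγ _,
    hinj.comp (add_left_injective N), fun n => ?_, ?_⟩
  · exact isCartanFlag_frameFlag hθ (hN _ (Nat.le_add_left _ _)) (h _)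
  · exact hF.comp (tendsto_add_atTop_nat N)

theorem dist_frame_lt_of_disjoint (P : Matrix.unitaryGroup (Fin d) K) (V : Gr K d j)
    {i : ℕ} (hi : i ≤ d) (hj : j ≤ d) (hij : j + i = d)
    (h : Disjoint V.carrier (frame (P * reversal) hi).carrier) :
    dist V (frame P hj) < Real.pi / 2 := by
  rw [frame_mul_reversal_carrier P hi hij] at h
  exact dist_frame_lt_pi_div_two V P hj h

/-- The cosine in `dist_frame_le` tends to `cos (dist W P) > 0`, so it eventually exceeds half of
this; hence `C = 2 / cos (dist W P)`. The plane `V n` varies because the estimate is needed along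
`γ_n x`. -/
theorem exists_eventually_dist_frame_le {γ : ℕ → PGL(d, K)}
    {L M : ℕ → Matrix.unitaryGroup (Fin d) K}
    (h : ∀ n, (rep (γ n)).1 = cartanMatrix (L n) (cartan (γ n)) (M n))
    (h1 : 1 ≤ j) (hjd : j < d) {P W : Gr K d j} {V : ℕ → Gr K d j}
    (hM : Tendsto (fun n => frame (M n)⁻¹ hjd.le) atTop (𝓝 P))
    (hV : Tendsto V atTop (𝓝 W)) (hW : dist W P < Real.pi / 2) :
    ∃ C : ℝ, ∀ᶠ n in atTop, dist (actGr (γ n) (V n)) (frame (L n) hjd.le)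
      ≤ C * Real.exp (-simpleRoot j (cartan (γ n))) := by
  have hd : Tendsto (fun n => dist (V n) (frame (M n)⁻¹ hjd.le)) atTop (𝓝 (dist W P)) :=
    hV.dist hM
  have hcos : 0 < Real.cos (dist W P) :=
    Real.cos_pos_of_mem_Ioo ⟨by linarith [Real.pi_pos, dist_nonneg (x := W) (y := P)], hW⟩
  have hc : Tendsto (fun n => Real.cos (dist (V n) (frame (M n)⁻¹ hjd.le))) atTop
      (𝓝 (Real.cos (dist W P))) := (Real.continuous_cos.tendsto _).comp hd
  refine ⟨(Real.cos (dist W P) / 2)⁻¹, ?_⟩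
  filter_upwards [hd.eventually_lt_const hW, hc.eventually_const_lt (half_lt_self hcos)]
    with n hn1 hn2
  refine (dist_frame_le (L n) (M n) (cartan_antitone (γ n)) h1 hjd (V n) (actGr (γ n) (V n))
    ?_ hn1).trans ?_
  · change (V n).carrier.map (repLin (γ n)) = _
    rw [repLin, h]
    rfl
  · rw [div_eq_inv_mul]
    gcongr

/-- The left factor of a chosen Cartan decomposition. -/
noncomputable def cartanLeft (g : PGL(d, K)) : Matrix.unitaryGroup (Fin d) K :=
  (exists_cartanMatrix_eq g).choose

/-- The right factor of a chosen Cartan decomposition. -/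
noncomputable def cartanRight (g : PGL(d, K)) : Matrix.unitaryGroup (Fin d) K :=
  (exists_cartanMatrix_eq g).choose_spec.choose

theorem rep_eq_cartanMatrix (g : PGL(d, K)) :
    (rep g).1 = cartanMatrix (cartanLeft g) (cartan g) (cartanRight g) :=
  (exists_cartanMatrix_eq g).choose_spec.choose_spec

/-- The flags all of whose subspaces of dimension `j` lie within `C exp(-α_j(κ(g)))` of the
attracting one of `g`. -/
def shadow (hθ : ∀ j ∈ θ, j ≤ d) (C : ℝ) (g : PGL(d, K)) : Set (Flag K d θ) :=
  {F | ∀ j : θ, dist (F.1 j) (frame (cartanLeft g) (hθ j j.2))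
    ≤ C * Real.exp (-simpleRoot j (cartan g))}

theorem infinite_shadow_of_mem_conicalLimitSet (hθ : ∀ j ∈ θ, 1 ≤ j ∧ j < d)
    (hsymm : ∀ j ∈ θ, d - j ∈ θ) {Γ : Subgroup PGL(d, K)} (hΓ : IsTransverse θ Γ)
    (hinf : (limitSet θ Γ).Infinite) {x : Flag K d θ} (hx : x ∈ conicalLimitSet θ Γ) :
    ∃ C : ℕ, {g : Γ | x ∈ shadow (fun j hj => (hθ j hj).2.le) C (g : PGL(d, K))}.Infinite := by
  -- For empty `θ` there is only one flag, so the limit set cannot be infinite.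
  rcases θ.eq_empty_or_nonempty with rfl | ⟨j₀, hj₀⟩
  · refine absurd (Set.toFinite (limitSet ∅ Γ)) ?_
    exact hinf
  have hd : 0 < d := by have := hθ j₀ hj₀; omega
  have hθ' : ∀ j ∈ θ, j ≤ d := fun j hj => (hθ j hj).2.le
  obtain ⟨-, γ₀, hγ₀, hinj₀, a, ha, b, hb, hab, hxa₀, hyb₀⟩ := hx
  obtain ⟨⟨L₀, M₀⟩, φ, hφ, hlim⟩ := CompactSpace.tendsto_subseq
    (fun n => (cartanLeft (γ₀ n)⁻¹, cartanRight (γ₀ n)⁻¹))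
  let γ : ℕ → PGL(d, K) := fun n => γ₀ (φ n)
  let g : ℕ → PGL(d, K) := fun n => (γ n)⁻¹
  let L : ℕ → Matrix.unitaryGroup (Fin d) K := fun n => cartanLeft (g n)
  let M : ℕ → Matrix.unitaryGroup (Fin d) K := fun n => cartanRight (g n)
  have hL : Tendsto L atTop (𝓝 L₀) := (continuous_fst.tendsto _).comp hlim
  have hM : Tendsto M atTop (𝓝 M₀) := (continuous_snd.tendsto _).comp hlim
  have hγ : ∀ n, γ n ∈ Γ := fun n => hγ₀ _
  have hg : ∀ n, g n ∈ Γ := fun n => Γ.inv_mem (hγ n)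
  have hinj : Function.Injective γ := hinj₀.comp hφ.injective
  have hginj : Function.Injective g := inv_injective.comp hinj
  have hxa : Tendsto (fun n => actFlag (γ n) x) atTop (𝓝 a) := hxa₀.comp hφ.tendsto_atTop
  have hrepg : ∀ n, (rep (g n)).1 = cartanMatrix (L n) (cartan (g n)) (M n) :=
    fun n => rep_eq_cartanMatrix (g n)
  choose L' hL' hrep' using fun n => exists_cartanMatrix_inv hd (hrepg n)
  -- The decompositions of `γ_n` and `g_n` must be compatible, so that a single subsequence controls
  -- the attracting and repelling flags of both.
  have hrepγ : ∀ n, (rep (γ n)).1 = cartanMatrix (L' n) (cartan (γ n)) (L n * reversal)⁻¹ := by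
    intro n
    have h1 := hrep' n
    rw [← cartan_inv] at h1
    simp only [g, inv_inv] at h1
    rw [h1, mul_inv_rev, reversal_inv]
  have hfrL' : Tendsto (fun n => frameFlag (L' n) hθ') atTop
      (𝓝 (frameFlag (M₀⁻¹ * reversal) hθ')) := by
    have h1 : Tendsto (fun n => frameFlag ((M n)⁻¹ * reversal) hθ') atTop
        (𝓝 (frameFlag (M₀⁻¹ * reversal) hθ')) :=
      ((continuous_frameFlag hθ').tendsto _).comp (hM.inv.mul_const _)
    refine h1.congr fun n => Subtype.ext (funext fun j => ?_)
    exact (hL' n (hθ' j j.2)).symm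
  have hplus : frameFlag L₀ hθ' ∈ limitSet θ Γ :=
    mem_limitSet_of_tendsto hθ' hΓ.1 hg hginj hrepg
      (((continuous_frameFlag hθ').tendsto _).comp hL)
  have hminus : frameFlag (M₀⁻¹ * reversal) hθ' ∈ limitSet θ Γ :=
    mem_limitSet_of_tendsto hθ' hΓ.1 hγ hinj hrepγ hfrL'
  -- Choose a limit point `y` different from `x` and from the limit of the repelling flags of `γ_n`;
  -- this uses that the limit set is infinite. Then `γ_n y` tends to `b` by conicality, and to the
  -- limit of the attracting flags of `γ_n` by contraction.
  have hbm : b = frameFlag (M₀⁻¹ * reversal) hθ' := by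
    obtain ⟨y, hyΛ, hy⟩ := (hinf.sdiff (Set.toFinite {x, frameFlag L₀ hθ'})).nonempty
    have hyx : y ≠ x := fun h => hy (by simp [h])
    have hyp : y ≠ frameFlag L₀ hθ' := fun h => hy (by simp [h])
    refine tendsto_nhds_unique ((hyb₀ y hyΛ hyx).comp hφ.tendsto_atTop)
      (tendsto_flag_iff.2 fun j => ?_)
    have hj := hθ j j.2
    have hcompl := hΓ.2 y hyΛ _ hplus hyp j ⟨d - j, hsymm j j.2⟩ (by simp; omega)
    have hlt : dist (y.1 j) (frame (L₀ * reversal) hj.2.le) < Real.pi / 2 := by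
      refine dist_frame_lt_of_disjoint _ _ (hθ' _ (hsymm j j.2)) hj.2.le (by omega) ?_
      have : L₀ * reversal * reversal = L₀ := by
        rw [mul_assoc]
        nth_rw 1 [← reversal_inv]
        rw [inv_mul_cancel, mul_one]
      rw [this]
      exact hcompl.disjoint
    have hP : Tendsto (fun n => frame ((L n * reversal)⁻¹)⁻¹ hj.2.le) atTop
        (𝓝 (frame (L₀ * reversal) hj.2.le)) := by
      simp only [inv_inv]
      exact ((continuous_frame hj.2.le).tendsto _).comp (hL.mul_const _)
    obtain ⟨C, hC⟩ := exists_eventually_dist_frame_le hrepγ hj.1 hj.2 hP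
      (tendsto_const_nhds (x := y.1 j)) hlt
    have hzero : Tendsto (fun n => C * Real.exp (-simpleRoot j (cartan (γ n)))) atTop (𝓝 0) := by
      rw [← mul_zero C]
      exact (Real.tendsto_exp_neg_atTop_nhds_zero.comp (hΓ.1 j j.2 γ hγ hinj)).const_mul C
    have hdist := squeeze_zero' (Eventually.of_forall fun n => dist_nonneg) hC hzero
    refine tendsto_of_tendsto_of_dist (tendsto_flag_iff.1 hfrL' j) ?_
    exact hdist.congr fun n => dist_comm _ _
  rw [hbm] at hab
  -- Write `x = g_n (γ_n x)`. The limit `a` of `γ_n x` is transverse to `b`, the limit of the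
  -- repelling flags of `g_n`, so the contraction applies with a uniform constant.
  have hC : ∀ j : θ, ∃ C : ℝ, ∀ᶠ n in atTop, dist (x.1 j) (frame (L n) (hθ' j j.2))
      ≤ C * Real.exp (-simpleRoot j (cartan (g n))) := by
    intro j
    have hj := hθ j j.2
    have hcompl := hΓ.2 a ha _ hminus hab j ⟨d - j, hsymm j j.2⟩ (by simp; omega)
    have hlt : dist (a.1 j) (frame M₀⁻¹ hj.2.le) < Real.pi / 2 :=
      dist_frame_lt_of_disjoint _ _ (hθ' _ (hsymm j j.2)) hj.2.le (by omega) hcompl.disjoint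
    have hP : Tendsto (fun n => frame (M n)⁻¹ hj.2.le) atTop (𝓝 (frame M₀⁻¹ hj.2.le)) :=
      ((continuous_frame hj.2.le).tendsto _).comp hM.inv
    obtain ⟨C, hC⟩ := exists_eventually_dist_frame_le hrepg hj.1 hj.2 hP
      (tendsto_flag_iff.1 hxa j) hlt
    refine ⟨C, hC.mono fun n hn => ?_⟩
    have : actGr (g n) ((actFlag (γ n) x).1 j) = x.1 j := actGr_inv_actGr hd (γ n) (x.1 j)
    rwa [this] at hn
  choose C hC using hC
  -- One constant for all `j`, and a natural number so that countably many constants cover all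
  -- conical points.
  obtain ⟨B, hB⟩ := exists_nat_ge (∑ j : θ, |C j|)
  have hev : ∀ᶠ n in atTop, x ∈ shadow hθ' B (g n) := by
    refine (eventually_all.2 hC).mono fun n hn j => (hn j).trans ?_
    gcongr
    exact (le_abs_self _).trans ((Finset.single_le_sum (f := fun j => |C j|)
      (fun _ _ => abs_nonneg _) (Finset.mem_univ j)).trans hB)
  obtain ⟨N, hN⟩ := eventually_atTop.1 hev
  refine ⟨B, Set.infinite_of_injective_forall_mem (f := fun n => (⟨g (n + N), hg _⟩ : Γ)) ?_
    fun n => hN _ (Nat.le_add_left _ _)⟩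
  intro m n hmn
  exact Nat.add_right_cancel (hginj (congrArg Subtype.val hmn))

/-! ### Hausdorff dimension -/

/-- The set of points lying in infinitely many of the sets `t i` has dimension at most `s` if
`∑ (diam t i) ^ s` converges. -/
theorem dimH_le_of_tsum_rpow_ne_top {X ι : Type*} [EMetricSpace X] {t : ι → Set X} {a : ι → ℝ≥0∞}
    (hta : ∀ i, Metric.ediam (t i) ≤ a i) (ha : ∀ i, a i ≠ 0) {s : ℝ≥0}
    (hs : ∑' i, a i ^ (s : ℝ) ≠ ∞) {E : Set X} (hE : ∀ x ∈ E, {i | x ∈ t i}.Infinite) :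
    dimH E ≤ s := by
  borelize X
  have hfin : ∀ ε : ℝ≥0∞, ε ≠ 0 → {i | ε ≤ a i ^ (s : ℝ)}.Finite := fun ε hε =>
    ENNReal.finite_const_le_of_tsum_ne_top hs hε
  -- At exponent `0` every term is `1`, so convergence leaves finitely many indices and `E` is
  -- empty.
  rcases eq_or_ne s 0 with rfl | hs0
  · have : Finite ι := by
      have := hfin 1 one_ne_zero
      simp only [NNReal.coe_zero, ENNReal.rpow_zero, le_refl, Set.ofPred_true] at this
      exact Set.finite_univ_iff.1 this
    have : E = ∅ := Set.eq_empty_of_forall_notMem fun x hx => hE x hx (Set.toFinite _)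
    simp [this]
  have hspos : (0 : ℝ) < s := by positivity
  -- A convergent sum has countable support, and no `a i` vanishes. This is the reason for using
  -- positive bounds `a i` instead of the diameters, which may be zero.
  have hcount : Countable ι := by
    have h1 := Summable.countable_support_ennreal hs
    have h2 : Function.support (fun i => a i ^ (s : ℝ)) = Set.univ := by
      refine Set.eq_univ_of_forall fun i h => ?_
      rcases ENNReal.rpow_eq_zero_iff.1 h with h | h
      · exact ha i h.1
      · exact absurd h.2 hspos.le.not_gt
    rw [h2] at h1
    exact Set.countable_univ_iff.1 h1
  refine dimH_le_of_hausdorffMeasure_ne_top (ne_top_of_le_ne_top ENNReal.zero_ne_top ?_)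
  -- The sets with index outside a finite `S` still cover `E`. Each `a i ^ s` is at most the tail
  -- sum, so the mesh of this cover is at most `r S`.
  let r : Finset ι → ℝ≥0∞ := fun S => (∑' i : {i // i ∉ S}, a i ^ (s : ℝ)) ^ (s : ℝ)⁻¹
  have htail : Tendsto (fun S : Finset ι => ∑' i : {i // i ∉ S}, a i ^ (s : ℝ)) atTop (𝓝 0) :=
    ENNReal.tendsto_tsum_compl_atTop_zero hs
  have hr : Tendsto r atTop (𝓝 0) := by
    have := (ENNReal.continuous_rpow_const (y := (s : ℝ)⁻¹)).tendsto 0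
    rw [ENNReal.zero_rpow_of_pos (inv_pos.2 hspos)] at this
    exact this.comp htail
  have hle := MeasureTheory.Measure.hausdorffMeasure_le_liminf_tsum
    (ι := fun S : Finset ι => {i // i ∉ S}) (s : ℝ) E r hr (fun S i => t i)
    (Eventually.of_forall fun S i => by
      refine (hta i).trans ?_
      rw [ENNReal.le_rpow_inv_iff hspos]
      exact ENNReal.le_tsum (f := fun i : {i // i ∉ S} => a i ^ (s : ℝ)) i)
    (Eventually.of_forall fun S x hx => by
      obtain ⟨i, hi, hiS⟩ := (hE x hx).exists_notMem_finset S
      exact Set.mem_iUnion.2 ⟨⟨i, hiS⟩, hi⟩)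
  refine hle.trans ?_
  have h0 : liminf (fun S : Finset ι => ∑' i : {i // i ∉ S}, a i ^ (s : ℝ)) atTop = 0 :=
    htail.liminf_eq
  rw [← h0]
  refine liminf_le_liminf (Eventually.of_forall fun S => ENNReal.tsum_le_tsum fun i => ?_)
  gcongr
  exact hta i

theorem ediam_shadow_le (hθ : ∀ j ∈ θ, j ≤ d) {C : ℝ} (hC : 0 ≤ C) (g : PGL(d, K)) :
    Metric.ediam (shadow hθ C g) ≤
      ENNReal.ofReal (2 * C * ∑ j : θ, Real.exp (-simpleRoot j (cartan g))) := by
  refine Metric.ediam_le fun F hF G hG => ?_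
  rw [edist_dist]
  refine ENNReal.ofReal_le_ofReal ?_
  have h0 : 0 ≤ ∑ j : θ, Real.exp (-simpleRoot j (cartan g)) :=
    Finset.sum_nonneg fun _ _ => (Real.exp_pos _).le
  rw [Subtype.dist_eq]
  refine (dist_pi_le_iff (by positivity)).2 fun j => ?_
  have h1 := hF j
  have h2 := hG j
  have h3 : Real.exp (-simpleRoot j (cartan g)) ≤ ∑ j : θ, Real.exp (-simpleRoot j (cartan g)) :=
    Finset.single_le_sum (f := fun j : θ => Real.exp (-simpleRoot j (cartan g)))
      (fun _ _ => (Real.exp_pos _).le) (Finset.mem_univ j)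
  calc dist (F.1 j) (G.1 j) ≤ _ := dist_triangle_right _ _ (frame (cartanLeft g) (hθ j j.2))
    _ ≤ 2 * C * Real.exp (-simpleRoot j (cartan g)) := by linarith
    _ ≤ _ := by gcongr

theorem dimH_conicalLimitSet_le {k : ℕ} (hk : 1 ≤ k) (hkd : k < d) (Γ : Subgroup PGL(d, K))
    (hΓ : IsTransverse {k, d - k} Γ) :
    dimH (conicalLimitSet {k, d - k} Γ) ≤ criticalExponent (simpleRoot k) Γ := by
  -- A finite limit set has dimension `0`; otherwise the third point needed for the shadows exists.
  by_cases hfin : (limitSet {k, d - k} Γ).Finite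
  · have : (conicalLimitSet {k, d - k} Γ).Countable :=
      (hfin.subset fun x hx => hx.1).countable
    rw [dimH_countable this]
    exact zero_le
  have hθ : ∀ j ∈ ({k, d - k} : Finset ℕ), 1 ≤ j ∧ j < d := by
    intro j hj
    simp only [Finset.mem_insert, Finset.mem_singleton] at hj
    omega
  have hsymm : ∀ j ∈ ({k, d - k} : Finset ℕ), d - j ∈ ({k, d - k} : Finset ℕ) := by
    intro j hj
    simp only [Finset.mem_insert, Finset.mem_singleton] at hj ⊢
    omega
  refine le_iInf₂ fun s hs => ?_
  let t : ℕ → Γ → Set (Flag K d {k, d - k}) :=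
    fun C g => shadow (fun j hj => (hθ j hj).2.le) C (g : PGL(d, K))
  have hsub : conicalLimitSet {k, d - k} Γ ⊆ ⋃ C : ℕ, {x | {g | x ∈ t C g}.Infinite} := fun x hx =>
    Set.mem_iUnion.2 (infinite_shadow_of_mem_conicalLimitSet hθ hsymm hΓ hfin hx)
  refine (dimH_mono hsub).trans ?_
  rw [dimH_iUnion]
  refine iSup_le fun C => ?_
  let e : Γ → ℝ≥0∞ := fun g => ENNReal.ofReal (Real.exp (-simpleRoot k (cartan (g : PGL(d, K)))))
  -- One factor `2` passes from radius to diameter, the other bounds the cardinality of `{k, d -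
  -- k}`. Using `C + 1` keeps `D` nonzero when `C = 0`.
  let D : ℝ≥0∞ := ENNReal.ofReal (2 * (C + 1) * 2)
  have he : ∑' g, e g ^ (s : ℝ) ≠ ∞ := by
    refine ne_of_lt (lt_of_eq_of_lt (tsum_congr fun g => ?_) hs)
    rw [ENNReal.ofReal_rpow_of_pos (Real.exp_pos _), ← Real.exp_mul]
    congr 2
    ring
  -- Inversion permutes `Γ`, so the terms coming from `α_{d-k}` have the same sum.
  have he' : ∑' g, e g⁻¹ ^ (s : ℝ) ≠ ∞ :=
    ne_of_eq_of_ne ((Equiv.inv Γ).tsum_eq fun g => e g ^ (s : ℝ)) he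
  refine dimH_le_of_tsum_rpow_ne_top (t := t C) (a := fun g => D * max (e g) (e g⁻¹))
    (fun g => ?_) (fun g => ?_) ?_ fun x hx => hx
  · have hinv : simpleRoot (d - k) (cartan (g : PGL(d, K)))
        = simpleRoot k (cartan ((g⁻¹ : Γ) : PGL(d, K))) :=
      (simpleRoot_cartan_inv (g : PGL(d, K)) hk (by omega) (by omega)).symm
    refine (ediam_shadow_le _ C.cast_nonneg _).trans ?_
    have hmax : D * max (e g) (e g⁻¹) = ENNReal.ofReal (2 * (C + 1) * 2 *
        max (Real.exp (-simpleRoot k (cartan (g : PGL(d, K)))))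
          (Real.exp (-simpleRoot k (cartan ((g⁻¹ : Γ) : PGL(d, K)))))) := by
      rw [ENNReal.ofReal_mul (by positivity), ENNReal.ofReal_max]
    rw [hmax]
    refine ENNReal.ofReal_le_ofReal ?_
    set m := max (Real.exp (-simpleRoot k (cartan (g : PGL(d, K)))))
          (Real.exp (-simpleRoot k (cartan ((g⁻¹ : Γ) : PGL(d, K))))) with hm
    have hm0 : 0 < m := lt_max_of_lt_left (Real.exp_pos _)
    have hsum : ∑ j : ({k, d - k} : Finset ℕ), Real.exp (-simpleRoot j (cartan (g : PGL(d, K))))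
        ≤ 2 * m := by
      refine (Finset.sum_le_card_nsmul _ _ m fun j _ => ?_).trans ?_
      · rcases Finset.mem_insert.1 j.2 with h | h
        · rw [h]; exact le_max_left _ _
        · rw [Finset.mem_singleton.1 h, hinv]; exact le_max_right _ _
      · rw [nsmul_eq_mul, Finset.card_univ, Fintype.card_coe]
        gcongr
        exact_mod_cast Finset.card_le_two
    calc _ ≤ 2 * (C : ℝ) * (2 * m) := by gcongr
      _ ≤ 2 * (C + 1) * 2 * m := by nlinarith
  · refine mul_ne_zero (ENNReal.ofReal_pos.2 (by positivity)).ne' ?_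
    exact (lt_max_of_lt_left (ENNReal.ofReal_pos.2 (Real.exp_pos _))).ne'
  · have hle : ∀ g, (D * max (e g) (e g⁻¹)) ^ (s : ℝ)
        ≤ D ^ (s : ℝ) * (e g ^ (s : ℝ) + e g⁻¹ ^ (s : ℝ)) := fun g => by
      rw [ENNReal.mul_rpow_of_nonneg _ _ s.coe_nonneg]
      gcongr
      rcases le_total (e g) (e g⁻¹) with h | h
      · rw [max_eq_right h]; exact le_add_self
      · rw [max_eq_left h]; exact le_self_add
    refine ne_top_of_le_ne_top ?_ (ENNReal.tsum_le_tsum hle)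
    rw [ENNReal.tsum_mul_left, ENNReal.tsum_add]
    exact ENNReal.mul_ne_top (ENNReal.rpow_ne_top_of_nonneg s.coe_nonneg ENNReal.ofReal_ne_top)
      (ENNReal.add_ne_top.2 ⟨he, he'⟩)

theorem dimH_conicalLimitSetGr_le (k : θ) (Γ : Subgroup PGL(d, K)) :
    dimH (conicalLimitSetGr θ k Γ) ≤ dimH (conicalLimitSet θ Γ) := by
  have : LipschitzWith 1 fun F : Flag K d θ => F.1 k :=
    LipschitzWith.of_dist_le_mul fun F G => by
      rw [NNReal.coe_one, one_mul, Subtype.dist_eq]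
      exact dist_le_pi_dist F.1 G.1 k
  exact this.dimH_image_le _

end TransverseGroup

theorem theorem1p2 {K : Type*} [RCLike K] {d k : ℕ} (hk : 1 ≤ k) (hkd : k < d)
    (Γ : Subgroup PGL(d, K)) (hΓ : TransverseGroup.IsTransverse {k, d - k} Γ) :
    dimH (TransverseGroup.conicalLimitSet {k, d - k} Γ)
        ≤ TransverseGroup.criticalExponent (TransverseGroup.simpleRoot k) Γ ∧
    dimH (TransverseGroup.conicalLimitSetGr {k, d - k} ⟨k, by simp⟩ Γ)
        ≤ TransverseGroup.criticalExponent (TransverseGroup.simpleRoot k) Γ :=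
  ⟨TransverseGroup.dimH_conicalLimitSet_le hk hkd Γ hΓ,
    (TransverseGroup.dimH_conicalLimitSetGr_le _ Γ).trans
      (TransverseGroup.dimH_conicalLimitSet_le hk hkd Γ hΓ)⟩
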